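/- Let $M$ be a finite-dimensional Hausdorff smooth manifold without boundary. Write $\Omega(M)=\bigoplus_p\Omega^p(M)$ for the differential forms on $M$ and $\Omega^p(M;TM)$ for the $TM$-valued $p$-forms. For $K\in\Omega^m(M;TM)$ let $i_K:\Omega(M)\to\Omega(M)$ be the insertion operator, of degree $m-1$: it vanishes on $\Omega^0(M)$, and for $\omega\in\Omega^{q+1}(M)$ $$(i_K\omega)(X_1,\dots,X_{m+q})=\frac1{m!\,q!}\sum_{\sigma\in S_{m+q}}\operatorname{sgn}(\sigma)\,\omega\bigl(K(X_{\sigma(1)},\dots,X_{\sigma(m)}),X_{\sigma(m+1)},\dots,X_{\sigma(m+q)}\bigr).$$ For operators $D_1,D_2$ on $\Omega(M)$ of degrees $k,l$ put $[D_1,D_2]=D_1D_2-(-1)^{kl}D_2D_1$, and put $\mathcal L_K=[i_K,d]$, of degree $m$. The Richardson–Nijenhuis bracket of $K\in\Omega^{k+1}(M;TM)$ and $L\in\Omega^{l+1}(M;TM)$ is the unique $[K,L]_{RN}\in\Omega^{k+l+1}(M;TM)$ with $[i_K,i_L]=i_{[K,L]_{RN}}$; the Frölicher–Nijenhuis bracket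 of $K\in\Omega^{k}(M;TM)$ and $L\in\Omega^{l}(M;TM)$ is the unique $[K,L]_{FN}\in\Omega^{k+l}(M;TM)$ with $[\mathcal L_K,\mathcal L_L]=\mathcal L_{[K,L]_{FN}}$. The Nijenhuis torsion of an endomorphism $N$ of $TM$ is $T_N=\tfrac12[N,N]_{FN}\in\Omega^2(M;TM)$, that is, $$T_N(X,Y)=[NX,NY]-N[NX,Y]-N[X,NY]+N^2[X,Y].$$ **Proposition.** Let $N:TM\to TM$ be an endomorphism with $N^2=N$ whose image is involutive (the vector fields with values in $\operatorname{Im}N$ are closed under the Lie bracket), and let $L=-T_N$. Then $NL=-T_N$, $[N,L]_{FN}=0$, $[L,L]_{RN}=0$, and $T_N(T_N(X,Y),Z)=0$ for all vector fields $X,Y,Z$. The same holds in the complex case: for complex-valued forms, complex vector fields $X+iY$, and a complex-linear endomorphism $N$ of the complexified tangent bundle $TM\otimes\mathbb C$, with the Lie bracket, $d$ and all the operations above extended complex-linearly. -/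

import Mathlib

set_option linter.unusedSectionVars false

namespace FrolicherNijenhuis

noncomputable section

open scoped Nat

/- Forms, insertion, exterior derivative and the two brackets, for a commutative ring `A` of
functions and an `A`-module `L` of vector fields. -/

section Forms
variable (A L : Type*) [CommRing A] [AddCommGroup L] [Module A L]

/-- The `p`-forms: alternating `A`-multilinear maps of `p` elements of `L` with values in `A`.
For `A` the smooth functions and `L` the vector fields on a manifold `M`, this is `Ω^p(M)`. -/
abbrev Form (p : ℕ) := L [⋀^Fin p]→ₗ[A] A

/-- The vector-valued `p`-forms: alternating `A`-multilinear maps of `p` elements of `L` with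
values in `L`.  For `A` the smooth functions and `L` the vector fields on a manifold `M`, this
is `Ω^p(M; TM)`. -/
abbrev VectorForm (p : ℕ) := L [⋀^Fin p]→ₗ[A] L

/-- All forms, `Ω = ⨁ p, Ω^p`. -/
abbrev Forms := DirectSum ℕ (fun p => Form A L p)
end Forms

section Insertion
variable {A L : Type*} [CommRing A] [AddCommGroup L] [Module A L] {m q : ℕ}

/-- The multilinear map `(Z₀, …) ↦ ω(K(Z₀, …, Z_{m-1}), Z_m, …, Z_{m+q-1})`. -/
def insertionAux (K : VectorForm A L m) (ω : Form A L (q + 1)) :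
    MultilinearMap A (fun _ : Fin (m + q) => L) A :=
  MultilinearMap.mk' (fun Z =>
      ω (Fin.cons (K fun i => Z (Fin.castAdd q i)) fun j => Z (Fin.natAdd m j)))
    (fun Z i x y => by
      have hl (i : Fin m) (z : L) : (fun k => Function.update Z (Fin.castAdd q i) z
          (Fin.castAdd q k)) = Function.update (fun k => Z (Fin.castAdd q k)) i z := by
        ext k; simp [Function.update_apply]
      have hl' (i : Fin m) (z : L) : (fun k => Function.update Z (Fin.castAdd q i) z
          (Fin.natAdd m k)) = fun k => Z (Fin.natAdd m k) := by
        ext k; simp [Function.update_apply, Fin.ext_iff]; grind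
      have hr (j : Fin q) (z : L) : (fun k => Function.update Z (Fin.natAdd m j) z
          (Fin.castAdd q k)) = fun k => Z (Fin.castAdd q k) := by
        ext k; simp [Function.update_apply, Fin.ext_iff]; grind
      have hr' (j : Fin q) (z : L) : (fun k => Function.update Z (Fin.natAdd m j) z
          (Fin.natAdd m k)) = Function.update (fun k => Z (Fin.natAdd m k)) j z := by
        ext k; simp [Function.update_apply]
      refine Fin.addCases (fun i => ?_) (fun i => ?_) i
      · simp only [hl, hl', AlternatingMap.map_update_add]
        exact ω.toMultilinearMap.cons_add _ _ _
      · simp only [hr, hr', Fin.cons_update, AlternatingMap.map_update_add])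
    (fun Z i c x => by
      have hl (i : Fin m) (z : L) : (fun k => Function.update Z (Fin.castAdd q i) z
          (Fin.castAdd q k)) = Function.update (fun k => Z (Fin.castAdd q k)) i z := by
        ext k; simp [Function.update_apply]
      have hl' (i : Fin m) (z : L) : (fun k => Function.update Z (Fin.castAdd q i) z
          (Fin.natAdd m k)) = fun k => Z (Fin.natAdd m k) := by
        ext k; simp [Function.update_apply, Fin.ext_iff]; grind
      have hr (j : Fin q) (z : L) : (fun k => Function.update Z (Fin.natAdd m j) z
          (Fin.castAdd q k)) = fun k => Z (Fin.castAdd q k) := by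
        ext k; simp [Function.update_apply, Fin.ext_iff]; grind
      have hr' (j : Fin q) (z : L) : (fun k => Function.update Z (Fin.natAdd m j) z
          (Fin.natAdd m k)) = Function.update (fun k => Z (Fin.natAdd m k)) j z := by
        ext k; simp [Function.update_apply]
      refine Fin.addCases (fun i => ?_) (fun i => ?_) i
      · simp only [hl, hl', AlternatingMap.map_update_smul]
        exact ω.toMultilinearMap.cons_smul _ _ _
      · simp only [hr, hr', Fin.cons_update, AlternatingMap.map_update_smul])

variable [Algebra ℝ A]

/-- Insertion of a vector-valued `m`-form in a `(q + 1)`-form: the sum over all permutations `σ` of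
`sgn σ • ω(K(Z_{σ 0}, …, Z_{σ (m-1)}), Z_{σ m}, …, Z_{σ (m+q-1)})`, divided by `m! q!`; this is
the sum over the `(m, q)`-shuffles, because each shuffle accounts for `m! q!` equal terms. -/
def insertionSucc (K : VectorForm A L m) (ω : Form A L (q + 1)) : Form A L (m + q) :=
  ((m ! * q ! : ℝ)⁻¹) • MultilinearMap.alternatization (insertionAux K ω)

/-- The insertion operator `i_K` on `Ω`; it vanishes on functions. -/
def insertion (K : VectorForm A L m) : Forms A L →+ Forms A L :=
  DirectSum.toAddMonoid fun p =>
    match p with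
    | 0 => 0
    | q + 1 => (DirectSum.of (fun p => Form A L p) (m + q)).comp
        (AddMonoidHom.mk' (insertionSucc K) fun ω η => by
          have h : insertionAux K (ω + η) = insertionAux K ω + insertionAux K η := by
            ext Z; rfl
          simp only [insertionSucc, h, map_add, smul_add])

end Insertion

section Ext
variable {A L : Type*} [CommRing A] [LieRing L] [Module A L] [LieRingModule L A] {n : ℕ}

/-- The Koszul formula for the exterior derivative of an `(n + 1)`-form,
`∑ i, (-1)^i X_i(ω(… omit X_i …)) + ∑ i < j, (-1)^(i+j) ω([X_i, X_j], … omit X_i, X_j …)`.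
In the second sum `(i, j)` stands for the pair of positions `i < j + 1`, hence the minus sign. -/
def koszul (ω : Form A L (n + 1)) (X : Fin (n + 2) → L) : A :=
  (∑ i : Fin (n + 2), (-1 : ℤ) ^ (i : ℕ) • ⁅X i, ω (i.removeNth X)⁆) -
    ∑ i : Fin (n + 1), ∑ j ≥ i, (-1 : ℤ) ^ (i + j : ℕ) •
      ω (Matrix.vecCons ⁅X i.castSucc, X j.succ⁆ (j.removeNth (i.castSucc.removeNth X)))

/-- A form, regarded as an additive alternating map. -/
def intForm (ω : Form A L n) : L [⋀^Fin n]→ₗ[ℤ] A :=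
  { ω.toMultilinearMap.restrictScalars ℤ with map_eq_zero_of_eq' := ω.map_eq_zero_of_eq' }

@[simp] theorem intForm_apply (ω : Form A L n) (X : Fin n → L) : intForm ω X = ω X := rfl

/-- The map `X ↦ (Z ↦ X(ω(Z)))`. -/
def actForm (ω : Form A L n) : L →ₗ[ℤ] L [⋀^Fin n]→ₗ[ℤ] A :=
  AddMonoidHom.toIntLinearMap <| AddMonoidHom.mk'
    (fun X => (AddMonoidHom.toIntLinearMap
      (AddMonoidHom.mk' (fun a : A => ⁅X, a⁆) (lie_add X))).compAlternatingMap (intForm ω))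
    (fun X Y => by ext Z; exact add_lie X Y (ω Z))

@[simp] theorem actForm_apply (ω : Form A L n) (X : L) (Z : Fin n → L) :
    actForm ω X Z = ⁅X, ω Z⁆ := rfl

/-- The map `(X, Y) ↦ ω([X, Y], …)`. -/
def bracketForm (ω : Form A L (n + 1)) : L →ₗ[ℤ] L →ₗ[ℤ] L [⋀^Fin n]→ₗ[ℤ] A :=
  LinearMap.mk₂ ℤ (fun X Y => (intForm ω).curryLeft ⁅X, Y⁆)
    (fun X Y Z => by rw [add_lie, map_add]) (fun c X Y => by rw [zsmul_lie, map_smul])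
    (fun X Y Z => by rw [lie_add, map_add]) (fun c X Y => by rw [lie_zsmul, map_smul])

@[simp] theorem bracketForm_apply (ω : Form A L (n + 1)) (X Y : L) (Z : Fin n → L) :
    bracketForm ω X Y Z = ω (Matrix.vecCons ⁅X, Y⁆ Z) := rfl

variable [Algebra ℝ A]

/-- The Koszul formula as an additive alternating map (see `intKoszul_apply`). -/
def intKoszul (ω : Form A L (n + 1)) : L [⋀^Fin (n + 2)]→ₗ[ℤ] A :=
  AlternatingMap.alternatizeUncurryFin (actForm ω) - (2⁻¹ : ℝ) •
    AlternatingMap.alternatizeUncurryFin (AlternatingMap.alternatizeUncurryFinLM ∘ₗ bracketForm ω)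

theorem intKoszul_apply (ω : Form A L (n + 1)) (X : Fin (n + 2) → L) :
    intKoszul ω X = koszul ω X := by
  rw [intKoszul, AlternatingMap.sub_apply, AlternatingMap.smul_apply,
    AlternatingMap.alternatizeUncurryFin_alternatizeUncurryFinLM_comp_apply,
    AlternatingMap.alternatizeUncurryFin_apply, koszul]
  congr 1
  simp only [Finset.smul_sum, bracketForm_apply]
  refine Finset.sum_congr rfl fun i _ => Finset.sum_congr rfl fun j _ => ?_
  have h : ω (Matrix.vecCons ⁅X j.succ, X i.castSucc⁆ (j.removeNth (i.castSucc.removeNth X))) =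
      - ω (Matrix.vecCons ⁅X i.castSucc, X j.succ⁆ (j.removeNth (i.castSucc.removeNth X))) := by
    rw [← lie_skew]
    have := ω.toMultilinearMap.cons_smul (j.removeNth (i.castSucc.removeNth X)) (-1)
      ⁅X i.castSucc, X j.succ⁆
    simpa using! this
  rw [h, sub_neg_eq_add, ← two_smul ℝ, smul_comm (2⁻¹ : ℝ), smul_smul]
  norm_num

variable [LieRinehartRing A L]

theorem map_cons_smul (ω : Form A L (n + 1)) (c : A) (x : L) (X : Fin n → L) :
    ω (Matrix.vecCons (c • x) X) = c • ω (Matrix.vecCons x X) :=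
  ω.toMultilinearMap.cons_smul X c x

theorem map_cons_cons_smul (ω : Form A L (n + 2)) (c : A) (b x : L) (X : Fin n → L) :
    ω (Matrix.vecCons b (Matrix.vecCons (c • x) X)) =
      c • ω (Matrix.vecCons b (Matrix.vecCons x X)) :=
  map_cons_smul (ω.curryLeft b) c x X

theorem removeNth_succ_vecCons (k : Fin (n + 1)) (x : L) (X : Fin (n + 1) → L) :
    k.succ.removeNth (Matrix.vecCons x X) = Matrix.vecCons x (k.removeNth X) := by
  ext i
  refine Fin.cases ?_ (fun i => ?_) i <;> simp [Fin.removeNth_apply]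

theorem koszul_vecCons (ω : Form A L (n + 1)) (x : L) (X : Fin (n + 1) → L) :
    koszul ω (Matrix.vecCons x X) = (⁅x, ω X⁆ +
      ∑ k : Fin (n + 1), (-1 : ℤ) ^ ((k : ℕ) + 1) •
        ⁅X k, ω (Matrix.vecCons x (k.removeNth X))⁆) -
      ((∑ j : Fin (n + 1), (-1 : ℤ) ^ (j : ℕ) • ω (Matrix.vecCons ⁅x, X j⁆ (j.removeNth X))) +
        ∑ i : Fin n, ∑ j ≥ i.succ, (-1 : ℤ) ^ (i + 1 + j : ℕ) •
          ω (Matrix.vecCons ⁅X i.castSucc, X j⁆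
            (j.removeNth (Matrix.vecCons x (i.castSucc.removeNth X))))) := by
  rw [koszul]
  congr 1
  · rw [Fin.sum_univ_succ]
    simp [removeNth_succ_vecCons]
  · rw [Fin.sum_univ_succ (n := n)]
    congr 1
    · have h0 : Finset.Ici (0 : Fin (n + 1)) = Finset.univ := by ext j; simp
      simp [h0]
    · refine Finset.sum_congr rfl fun i _ => Finset.sum_congr rfl fun j _ => ?_
      rw [← Fin.succ_castSucc, removeNth_succ_vecCons]
      simp

theorem koszul_cons_smul (ω : Form A L (n + 1)) (c : A) (x : L) (X : Fin (n + 1) → L) :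
    koszul ω (Matrix.vecCons (c • x) X) = c • koszul ω (Matrix.vecCons x X) := by
  have h1 : ∀ k : Fin (n + 1), (-1 : ℤ) ^ ((k : ℕ) + 1) •
        ⁅X k, ω (Matrix.vecCons (c • x) (k.removeNth X))⁆ =
      c • ((-1 : ℤ) ^ ((k : ℕ) + 1) • ⁅X k, ω (Matrix.vecCons x (k.removeNth X))⁆) -
        (-1 : ℤ) ^ (k : ℕ) • (⁅X k, c⁆ * ω (Matrix.vecCons x (k.removeNth X))) := by
    intro k
    rw [map_cons_smul, smul_eq_mul, LieRinehartRing.leibniz_mul_right, smul_add, pow_succ,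
      smul_comm c]
    simp [sub_eq_add_neg]
  have h2 : ∀ j : Fin (n + 1), (-1 : ℤ) ^ (j : ℕ) •
        ω (Matrix.vecCons ⁅c • x, X j⁆ (j.removeNth X)) =
      c • ((-1 : ℤ) ^ (j : ℕ) • ω (Matrix.vecCons ⁅x, X j⁆ (j.removeNth X))) -
        (-1 : ℤ) ^ (j : ℕ) • (⁅X j, c⁆ * ω (Matrix.vecCons x (j.removeNth X))) := by
    intro j
    have hb : ⁅c • x, X j⁆ = c • ⁅x, X j⁆ + (-⁅X j, c⁆) • x := by
      rw [← lie_skew, LieRinehartRing.leibniz_smul_right, ← lie_skew x (X j)]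
      module
    have ha : ω (Matrix.vecCons (c • ⁅x, X j⁆ + (-⁅X j, c⁆) • x) (j.removeNth X)) =
        ω (Matrix.vecCons (c • ⁅x, X j⁆) (j.removeNth X)) +
          ω (Matrix.vecCons ((-⁅X j, c⁆) • x) (j.removeNth X)) :=
      ω.toMultilinearMap.cons_add _ _ _
    rw [hb, ha, map_cons_smul, map_cons_smul, smul_add, smul_comm c]
    simp [sub_eq_add_neg]
  have h3 : ∀ (i : Fin n), ∀ j ≥ i.succ, (-1 : ℤ) ^ (i + 1 + j : ℕ) •
          ω (Matrix.vecCons ⁅X i.castSucc, X j⁆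
            (j.removeNth (Matrix.vecCons (c • x) (i.castSucc.removeNth X)))) =
      c • ((-1 : ℤ) ^ (i + 1 + j : ℕ) • ω (Matrix.vecCons ⁅X i.castSucc, X j⁆
            (j.removeNth (Matrix.vecCons x (i.castSucc.removeNth X))))) := by
    intro i j hj
    cases n with
    | zero => exact i.elim0
    | succ n =>
      obtain ⟨k, rfl⟩ : ∃ k, j = Fin.succ k :=
        (Fin.exists_succ_eq.2 (fun h => by simp [h] at hj)).imp fun _ h => h.symm
      rw [removeNth_succ_vecCons, removeNth_succ_vecCons, map_cons_cons_smul, smul_comm c]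
  rw [koszul_vecCons, koszul_vecCons, Finset.sum_congr rfl fun k _ => h1 k,
    Finset.sum_congr rfl fun k _ => h2 k,
    Finset.sum_congr rfl fun i _ => Finset.sum_congr rfl fun j hj => h3 i j (by simpa using hj)]
  simp only [Finset.sum_sub_distrib, LieRinehartRing.lie_smul_eq_mul, smul_eq_mul, mul_sub,
    mul_add, Finset.mul_sum]
  ring

/-- The exterior derivative of an `(n + 1)`-form. -/
def extDerivSucc (ω : Form A L (n + 1)) : Form A L (n + 2) where
  toFun := koszul ω
  map_update_add' X i x y := by
    simp only [← intKoszul_apply]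
    exact (intKoszul ω).map_update_add' X i x y
  map_update_smul' X i c x := by
    have key : ∀ z : L, koszul ω (Function.update X i z) =
        (-1 : ℤ) ^ (i : ℕ) • koszul ω (Matrix.vecCons z (i.removeNth X)) := by
      intro z
      rw [← intKoszul_apply, ← intKoszul_apply, ← AlternatingMap.map_insertNth]
      congr 1
      rw [Fin.insertNth_removeNth]
      convert! rfl
    rw [key, key, koszul_cons_smul, smul_comm]
  map_eq_zero_of_eq' X i j h hij := by
    rw [← intKoszul_apply]
    exact (intKoszul ω).map_eq_zero_of_eq' X i j h hij

/-- The exterior derivative of a function: `df(X) = X(f)`. -/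
def extDerivZero (f : Form A L 0) : Form A L 1 :=
  AlternatingMap.ofSubsingleton A L A (0 : Fin 1)
    { toFun := fun X => ⁅X, f ![]⁆
      map_add' := fun X Y => add_lie X Y _
      map_smul' := fun c X => LieRinehartRing.lie_smul_eq_mul c _ X }

/-- The exterior derivative `d` on `Ω`. -/
def extDeriv : Forms A L →+ Forms A L :=
  DirectSum.toAddMonoid fun p =>
    match p with
    | 0 => (DirectSum.of (fun p => Form A L p) 1).comp
        (AddMonoidHom.mk' extDerivZero fun f g => by ext X; exact lie_add _ _ _)
    | n + 1 => (DirectSum.of (fun p => Form A L p) (n + 2)).comp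
        (AddMonoidHom.mk' extDerivSucc fun ω η => by
          ext X
          change koszul (ω + η) X = koszul ω X + koszul η X
          simp only [koszul, AlternatingMap.add_apply, lie_add, smul_add, Finset.sum_add_distrib]
          abel)

/-- The graded commutator `D₁ D₂ - (-1)^(k l) D₂ D₁` of operators of degrees `k` and `l`. -/
def gradedCommutator (k l : ℤ) (D₁ D₂ : AddMonoid.End (Forms A L)) : AddMonoid.End (Forms A L) :=
  D₁ * D₂ - (Int.negOnePow (k * l) : ℤ) • (D₂ * D₁)

/-- The Lie derivative along a vector-valued `k`-form `K`: the graded commutator of `i_K`, which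
has degree `k - 1`, and `d`, which has degree `1`. -/
def lieDerivative {k : ℕ} (K : VectorForm A L k) : AddMonoid.End (Forms A L) :=
  gradedCommutator ((k : ℤ) - 1) 1 (insertion K) extDeriv

/-- `R` is the Richardson-Nijenhuis bracket of `K ∈ Ω^(k+1)` and `K' ∈ Ω^(l+1)`: the unique
vector-valued form with `[i_K, i_K'] = i_R`. -/
structure IsRNBracket {k l : ℕ} (K : VectorForm A L (k + 1)) (K' : VectorForm A L (l + 1))
    (R : VectorForm A L (k + l + 1)) : Prop where
  comm : gradedCommutator (k : ℤ) (l : ℤ) (insertion K) (insertion K') = insertion R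
  unique : ∀ S : VectorForm A L (k + l + 1),
    gradedCommutator (k : ℤ) (l : ℤ) (insertion K) (insertion K') = insertion S → S = R

/-- `R` is the Frölicher-Nijenhuis bracket of `K ∈ Ω^k` and `K' ∈ Ω^l`: the unique
vector-valued form whose Lie derivative is the graded commutator of those along `K` and `K'`. -/
structure IsFNBracket {k l : ℕ} (K : VectorForm A L k) (K' : VectorForm A L l)
    (R : VectorForm A L (k + l)) : Prop where
  comm : gradedCommutator (k : ℤ) (l : ℤ) (lieDerivative K) (lieDerivative K') = lieDerivative R
  unique : ∀ S : VectorForm A L (k + l),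
    gradedCommutator (k : ℤ) (l : ℤ) (lieDerivative K) (lieDerivative K') = lieDerivative S → S = R

/-- An endomorphism as a vector-valued `1`-form. -/
def endForm (N : L →ₗ[A] L) : VectorForm A L 1 := AlternatingMap.ofSubsingleton A L L (0 : Fin 1) N

/-- The Nijenhuis torsion `T_N(X, Y) = [NX, NY] - N[NX, Y] - N[X, NY] + N²[X, Y]`. -/
def torsion (N : L →ₗ[A] L) : VectorForm A L 2 :=
  { MultilinearMap.mk' (fun X : Fin 2 → L =>
      ⁅N (X 0), N (X 1)⁆ - N ⁅N (X 0), X 1⁆ - N ⁅X 0, N (X 1)⁆ + N (N ⁅X 0, X 1⁆))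
      (fun X i x y => by
        fin_cases i <;> simp [add_lie, lie_add] <;> abel)
      (fun X i c x => by
        have hs : ∀ (a : A) (u v : L), ⁅a • u, v⁆ = a • ⁅u, v⁆ - ⁅v, a⁆ • u := by
          intro a u v
          rw [← lie_skew, LieRinehartRing.leibniz_smul_right, ← lie_skew u v]
          module
        fin_cases i
        · simp [hs]
          module
        · simp
          module) with
    map_eq_zero_of_eq' := fun X i j h hij => by
      have h01 : X 0 = X 1 := by
        fin_cases i <;> fin_cases j <;> simp_all
      change ⁅N (X 0), N (X 1)⁆ - N ⁅N (X 0), X 1⁆ - N ⁅X 0, N (X 1)⁆ + N (N ⁅X 0, X 1⁆) = 0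
      rw [h01, ← lie_skew (N (X 1)) (X 1), lie_self, lie_self, map_neg, map_zero, map_zero]
      abel }

/-- The image of `N` is closed under the Lie bracket. -/
def HasInvolutiveImage (N : L →ₗ[A] L) : Prop :=
  ∀ X ∈ LinearMap.range N, ∀ Y ∈ LinearMap.range N, ⁅X, Y⁆ ∈ LinearMap.range N

end Ext

/- Real and complex vector fields on a manifold. -/

open scoped Manifold ContDiff Bundle
open VectorField

section Real
variable {E : Type*} [NormedAddCommGroup E] [NormedSpace ℝ E] [FiniteDimensional ℝ E]
  {H : Type*} [TopologicalSpace H] (I : ModelWithCorners ℝ E H)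
  (M : Type*) [TopologicalSpace M] [ChartedSpace H M] [IsManifold I ∞ M]

/-- Smooth real functions on `M`. -/
abbrev SmoothFunction := C^∞⟮I, M; 𝓘(ℝ, ℝ), ℝ⟯
/-- Smooth vector fields: smooth sections of the tangent bundle.  They carry the Lie bracket
`mlieBracket`, and act on functions by differentiation; `C^∞(M)`-linear endomorphisms of this
module are the endomorphisms of the bundle `TM`. -/
abbrev SmoothVectorField := Cₛ^∞⟮I; E, (TangentSpace I : M → Type _)⟯

variable {I M}
namespace SmoothVectorField

instance : SMul (SmoothFunction I M) (SmoothVectorField I M) :=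
  ⟨fun f X => ⟨fun x => f x • X x, f.contMDiff.smul_section X.contMDiff⟩⟩

@[simp] theorem fun_smul_apply (f : SmoothFunction I M) (X : SmoothVectorField I M) (x : M) :
    (f • X) x = f x • X x := rfl

instance : Module (SmoothFunction I M) (SmoothVectorField I M) where
  one_smul X := by ext x; exact one_smul ℝ (X x)
  mul_smul f g X := by ext x; exact mul_smul (f x) (g x) (X x)
  smul_zero f := by ext x; exact smul_zero (f x)
  smul_add f X Y := by ext x; exact smul_add (f x) (X x) (Y x)
  add_smul f g X := by ext x; exact add_smul (f x) (g x) (X x)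
  zero_smul X := by ext x; exact zero_smul ℝ (X x)

theorem mdiffAt (X : SmoothVectorField I M) (x : M) :
    MDifferentiableAt I I.tangent (fun y => (⟨y, X y⟩ : TangentBundle I M)) x := 
  X.mdifferentiableAt

instance : Bracket (SmoothVectorField I M) (SmoothVectorField I M) :=
  ⟨fun X Y => ⟨mlieBracket I X Y, fun x => by
    have : CompleteSpace E := FiniteDimensional.complete ℝ E
    have : IsManifold I ((⊤ : ℕ∞) + 1) M := by simpa using (inferInstance : IsManifold I ∞ M)
    have : IsManifold I (minSmoothness ℝ 2) M := by
      simpa using (inferInstance : IsManifold I 2 M)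
    exact ContMDiffAt.mlieBracket_vectorField (m := ⊤) (n := ⊤) (X.contMDiff x) (Y.contMDiff x)
      (by simp)⟩⟩

@[simp] theorem lie_apply (X Y : SmoothVectorField I M) (x : M) :
    (⁅X, Y⁆ : SmoothVectorField I M) x = mlieBracket I X Y x := rfl

theorem two_le_smooth : minSmoothness ℝ 2 ≤ ∞ := by
  simpa using (WithTop.coe_le_coe.2 (le_top : (2 : ℕ∞) ≤ ⊤))

instance : LieRing (SmoothVectorField I M) where
  add_lie X Y Z := by ext x; exact mlieBracket_add_left (X.mdiffAt x) (Y.mdiffAt x)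
  lie_add X Y Z := by ext x; exact mlieBracket_add_right (Y.mdiffAt x) (Z.mdiffAt x)
  lie_self X := by ext x; simp
  leibniz_lie X Y Z := by
    have : CompleteSpace E := FiniteDimensional.complete ℝ E
    have : IsManifold I (minSmoothness ℝ 3) M := by simpa using (inferInstance : IsManifold I 3 M)
    ext x
    exact leibniz_identity_mlieBracket_apply ((X.contMDiff x).of_le two_le_smooth)
      ((Y.contMDiff x).of_le two_le_smooth) ((Z.contMDiff x).of_le two_le_smooth)

instance : Bracket (SmoothVectorField I M) (SmoothFunction I M) :=
  ⟨fun X f => ⟨fun x => mvfderiv I f x (X x), by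
    have h1 := (f.contMDiff.contMDiff_tangentMap (m := ∞) (by simp)).comp X.contMDiff
    exact (contMDiff_snd_tangentBundle_modelSpace ℝ 𝓘(ℝ, ℝ)).comp h1⟩⟩

@[simp] theorem lie_fun_apply (X : SmoothVectorField I M) (f : SmoothFunction I M) (x : M) :
    (⁅X, f⁆ : SmoothFunction I M) x = mvfderiv I f x (X x) := rfl


theorem lie_lie_fun_aux (X Y : SmoothVectorField I M) (f : SmoothFunction I M) (x : M)
    (v : TangentSpace I x) :
    (⁅⁅X, Y⁆, f⁆ : SmoothFunction I M) x • v =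
      ((⁅X, ⁅Y, f⁆⁆ : SmoothFunction I M) x - (⁅Y, ⁅X, f⁆⁆ : SmoothFunction I M) x) • v := by
  have : CompleteSpace E := FiniteDimensional.complete ℝ E
  have i3 : IsManifold I (minSmoothness ℝ 3) M := by simpa using (inferInstance : IsManifold I 3 M)
  have i2 : IsManifold I (minSmoothness ℝ 2) M := by simpa using (inferInstance : IsManifold I 2 M)
  have i21 : IsManifold I ((2 : ℕ∞) + 1) M := by
    have h : ((2 : ℕ∞) : WithTop ℕ∞) + 1 = 3 := by norm_num
    rw [h]; infer_instance
  let Z : ∀ y : M, TangentSpace I y := FiberBundle.extend E v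
  have hZx : Z x = v := by simp [Z]
  have hZ : ContMDiffAt I I.tangent ∞ (fun y => (⟨y, Z y⟩ : TangentBundle I M)) x :=
    FiberBundle.contMDiffAt_extend I E v
  have hZd : ∀ᶠ y in nhds x, MDifferentiableAt I I.tangent
      (fun y => (⟨y, Z y⟩ : TangentBundle I M)) y := by
    have h1 := (contMDiffAt_iff_contMDiffAt_nhds (n := 1) (by simp)).1 (hZ.of_le (by simp))
    exact h1.mono fun y hy => hy.mdifferentiableAt one_ne_zero
  have key : ∀ (W : SmoothVectorField I M),
      mlieBracket I W ((f : M → ℝ) • Z) =ᶠ[nhds x]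
        ((⁅W, f⁆ : SmoothFunction I M) : M → ℝ) • Z + (f : M → ℝ) • mlieBracket I W Z := by
    intro W
    filter_upwards [hZd] with y hy
    exact mlieBracket_smul_right f.mdifferentiableAt hy
  have hb : ∀ (W : SmoothVectorField I M), MDifferentiableAt I I.tangent
      (fun y => (⟨y, mlieBracket I W Z y⟩ : TangentBundle I M)) x := by
    intro W
    have := ContMDiffAt.mlieBracket_vectorField (m := 1) (n := 2)
      ((W.contMDiff x).of_le (by simpa using two_le_smooth))
      (hZ.of_le (by simpa using two_le_smooth)) (by simp; norm_num)
    exact this.mdifferentiableAt one_ne_zero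
  have key2 : ∀ U W : SmoothVectorField I M,
      mlieBracket I U (mlieBracket I W ((f : M → ℝ) • Z)) x =
        (⁅U, ⁅W, f⁆⁆ : SmoothFunction I M) x • v + ⁅W, f⁆ x • mlieBracket I U Z x +
          (⁅U, f⁆ x • mlieBracket I W Z x + f x • mlieBracket I U (mlieBracket I W Z) x) := by
    intro U W
    refine (Filter.EventuallyEq.mlieBracket_vectorField_eq
      (Filter.EventuallyEq.refl _ _) (key W)).trans ?_
    rw [mlieBracket_add_right, mlieBracket_smul_right (f := (⁅W, f⁆ : SmoothFunction I M)),
      mlieBracket_smul_right f.mdifferentiableAt (hb W), hZx]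
    · rfl
    · exact ContMDiffMap.mdifferentiableAt _
    · exact hZd.self_of_nhds
    · exact (ContMDiffMap.mdifferentiableAt _).smul_section hZd.self_of_nhds
    · exact f.mdifferentiableAt.smul_section (hb W)
  have hfZ : ContMDiffAt I I.tangent ∞
      (fun y => (⟨y, ((f : M → ℝ) • Z) y⟩ : TangentBundle I M)) x :=
    f.contMDiff.contMDiffAt.smul_section hZ
  have j1 := leibniz_identity_mlieBracket_apply ((X.contMDiff x).of_le two_le_smooth)
      ((Y.contMDiff x).of_le two_le_smooth) (hfZ.of_le two_le_smooth)
  have j2 := leibniz_identity_mlieBracket_apply ((X.contMDiff x).of_le two_le_smooth)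
      ((Y.contMDiff x).of_le two_le_smooth) (hZ.of_le two_le_smooth)
  have k := (key ⁅X, Y⁆).self_of_nhds
  simp only [Pi.add_apply, Pi.smul_apply', hZx] at k
  have k' : mlieBracket I (mlieBracket I X Y) ((f : M → ℝ) • Z) x =
    ⁅⁅X, Y⁆, f⁆ x • v + f x • mlieBracket I (mlieBracket I X Y) Z x := k
  rw [key2, key2, k', j2, smul_add] at j1
  rw [sub_smul, eq_sub_iff_add_eq]
  have := sub_eq_zero.2 j1
  rw [← sub_eq_zero, ← neg_eq_zero, ← this]
  abel

instance : LieRingModule (SmoothVectorField I M) (SmoothFunction I M) where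
  add_lie X Y f := by ext x; exact map_add (mvfderiv I f x) (X x) (Y x)
  lie_add X f g := by
    ext x
    exact congr($(mvfderiv_add (f.mdifferentiableAt (x := x)) g.mdifferentiableAt) (X x))
  leibniz_lie X Y f := by
    ext x
    change (⁅X, ⁅Y, f⁆⁆ : SmoothFunction I M) x =
      (⁅⁅X, Y⁆, f⁆ : SmoothFunction I M) x + (⁅Y, ⁅X, f⁆⁆ : SmoothFunction I M) x
    rcases subsingleton_or_nontrivial E with hE | hE
    · have hz : ∀ (W : SmoothVectorField I M) (g : SmoothFunction I M),
          (⁅W, g⁆ : SmoothFunction I M) x = 0 := by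
        intro W g
        have : W x = 0 := @Subsingleton.elim E hE _ _
        rw [lie_fun_apply, this, map_zero]
      rw [hz, hz, hz, add_zero]
    · obtain ⟨v, hv⟩ := exists_ne (0 : E)
      have h := lie_lie_fun_aux X Y f x v
      have h' := smul_left_injective ℝ (M := E) hv h
      rw [h']
      abel

instance : LieRinehartRing (SmoothFunction I M) (SmoothVectorField I M) where
  lie_smul_eq_mul' f g X := by ext x; exact map_smul (mvfderiv I g x) (f x) (X x)
  leibniz_mul_right' X f g := by
    ext x
    have h := congr($(mvfderiv_mul (f.mdifferentiableAt (x := x)) g.mdifferentiableAt) (X x))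
    refine h.trans ?_
    simp [mul_comm]
  leibniz_smul_right' X Y f := by
    have : CompleteSpace E := FiniteDimensional.complete ℝ E
    ext x
    refine (mlieBracket_smul_right f.mdifferentiableAt (Y.mdiffAt x)).trans ?_
    exact add_comm _ _

end SmoothVectorField
end Real

section Complex
variable {E : Type*} [NormedAddCommGroup E] [NormedSpace ℝ E]
  {H : Type*} [TopologicalSpace H] (I : ModelWithCorners ℝ E H)
  (M : Type*) [TopologicalSpace M] [ChartedSpace H M]

/-- Multiplication of complex numbers is smooth over `ℝ`. -/
instance complexContMDiffRing : ContMDiffRing 𝓘(ℝ, ℂ) ∞ ℂ where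
  toContMDiffAdd := inferInstance
  contMDiff_mul := by
    rw [← modelWithCornersSelf_prod, chartedSpaceSelf_prod]
    exact contDiff_mul.contMDiff

/-- Smooth complex-valued functions. -/
abbrev ComplexSmoothFunction := C^∞⟮I, M; 𝓘(ℝ, ℂ), ℂ⟯

variable {I M}
namespace ComplexSmoothFunction

/-- The real part of a complex-valued function. -/
def re (f : ComplexSmoothFunction I M) : SmoothFunction I M :=
  ⟨fun x => (f x).re, Complex.reCLM.contMDiff.comp f.contMDiff⟩

/-- The imaginary part of a complex-valued function. -/
def im (f : ComplexSmoothFunction I M) : SmoothFunction I M :=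
  ⟨fun x => (f x).im, Complex.imCLM.contMDiff.comp f.contMDiff⟩

/-- The complex-valued function `u + i v`. -/
def mk (u v : SmoothFunction I M) : ComplexSmoothFunction I M :=
  ⟨fun x => ⟨u x, v x⟩, by
    have h := (Complex.ofRealCLM.contMDiff.comp u.contMDiff).add
      ((contMDiff_const (c := Complex.I)).mul (Complex.ofRealCLM.contMDiff.comp v.contMDiff))
    convert! h using 1
    ext x
    simp [Complex.ext_iff]⟩

theorem ext_re_im {f g : ComplexSmoothFunction I M} (h : re f = re g) (h' : im f = im g) :
    f = g := by
  ext x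
  exact Complex.ext congr($h x) congr($h' x)

@[simp] theorem re_mk (u v : SmoothFunction I M) : re (mk u v) = u := rfl
@[simp] theorem im_mk (u v : SmoothFunction I M) : im (mk u v) = v := rfl
@[simp] theorem re_zero : re (0 : ComplexSmoothFunction I M) = 0 := rfl
@[simp] theorem im_zero : im (0 : ComplexSmoothFunction I M) = 0 := rfl
@[simp] theorem re_one : re (1 : ComplexSmoothFunction I M) = 1 := rfl
@[simp] theorem im_one : im (1 : ComplexSmoothFunction I M) = 0 := rfl
@[simp] theorem re_add (f g : ComplexSmoothFunction I M) : re (f + g) = re f + re g := rfl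
@[simp] theorem im_add (f g : ComplexSmoothFunction I M) : im (f + g) = im f + im g := rfl
@[simp] theorem re_mul (f g : ComplexSmoothFunction I M) :
    re (f * g) = re f * re g - im f * im g := rfl
@[simp] theorem im_mul (f g : ComplexSmoothFunction I M) :
    im (f * g) = re f * im g + im f * re g := rfl

end ComplexSmoothFunction

variable (I M) in
/-- Complex vector fields: smooth sections `X + i Y` of `TM ⊕ i TM`.  The Lie bracket and the
action on functions below are the complex-bilinear extensions of the real ones. -/
@[ext]
structure ComplexVectorField [IsManifold I ∞ M] where
  /-- The real part `X`. -/
  re : SmoothVectorField I M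
  /-- The imaginary part `Y`. -/
  im : SmoothVectorField I M

namespace ComplexVectorField
open ComplexSmoothFunction
variable [IsManifold I ∞ M]

instance : Zero (ComplexVectorField I M) := ⟨⟨0, 0⟩⟩
instance : Add (ComplexVectorField I M) := ⟨fun Z W => ⟨Z.re + W.re, Z.im + W.im⟩⟩
instance : Neg (ComplexVectorField I M) := ⟨fun Z => ⟨-Z.re, -Z.im⟩⟩
instance : Sub (ComplexVectorField I M) := ⟨fun Z W => ⟨Z.re - W.re, Z.im - W.im⟩⟩
instance : SMul ℕ (ComplexVectorField I M) := ⟨fun n Z => ⟨n • Z.re, n • Z.im⟩⟩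
instance : SMul ℤ (ComplexVectorField I M) := ⟨fun n Z => ⟨n • Z.re, n • Z.im⟩⟩

instance : AddCommGroup (ComplexVectorField I M) :=
  Function.Injective.addCommGroup (fun Z : ComplexVectorField I M => (Z.re, Z.im))
    (fun _ _ h => ComplexVectorField.ext congr($h.1) congr($h.2)) rfl (fun _ _ => rfl)
    (fun _ => rfl) (fun _ _ => rfl) (fun _ _ => rfl) (fun _ _ => rfl)

instance : SMul (ComplexSmoothFunction I M) (ComplexVectorField I M) :=
  ⟨fun f Z => ⟨ComplexSmoothFunction.re f • Z.re - ComplexSmoothFunction.im f • Z.im,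
    ComplexSmoothFunction.re f • Z.im + ComplexSmoothFunction.im f • Z.re⟩⟩

instance : Bracket (ComplexVectorField I M) (ComplexSmoothFunction I M) :=
  ⟨fun Z f => ComplexSmoothFunction.mk
    (⁅Z.re, ComplexSmoothFunction.re f⁆ - ⁅Z.im, ComplexSmoothFunction.im f⁆)
    (⁅Z.re, ComplexSmoothFunction.im f⁆ + ⁅Z.im, ComplexSmoothFunction.re f⁆)⟩

@[simp] theorem re_zero : (0 : ComplexVectorField I M).re = 0 := rfl
@[simp] theorem im_zero : (0 : ComplexVectorField I M).im = 0 := rfl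
@[simp] theorem re_add (Z W : ComplexVectorField I M) : (Z + W).re = Z.re + W.re := rfl
@[simp] theorem im_add (Z W : ComplexVectorField I M) : (Z + W).im = Z.im + W.im := rfl
@[simp] theorem re_smul (f : ComplexSmoothFunction I M) (Z : ComplexVectorField I M) :
    (f • Z).re = f.re • Z.re - f.im • Z.im := rfl
@[simp] theorem im_smul (f : ComplexSmoothFunction I M) (Z : ComplexVectorField I M) :
    (f • Z).im = f.re • Z.im + f.im • Z.re := rfl
@[simp] theorem re_lie_fun (Z : ComplexVectorField I M) (f : ComplexSmoothFunction I M) :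
    ComplexSmoothFunction.re ⁅Z, f⁆ =
      ⁅Z.re, ComplexSmoothFunction.re f⁆ - ⁅Z.im, ComplexSmoothFunction.im f⁆ := rfl
@[simp] theorem im_lie_fun (Z : ComplexVectorField I M) (f : ComplexSmoothFunction I M) :
    ComplexSmoothFunction.im ⁅Z, f⁆ =
      ⁅Z.re, ComplexSmoothFunction.im f⁆ + ⁅Z.im, ComplexSmoothFunction.re f⁆ := rfl

instance : Module (ComplexSmoothFunction I M) (ComplexVectorField I M) where
  one_smul Z := by ext1 <;> simp
  mul_smul f g Z := by
    ext1 <;> simp only [re_smul, im_smul, re_mul, im_mul] <;> module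
  smul_zero f := by ext1 <;> simp
  smul_add f Z W := by ext1 <;> simp only [re_smul, im_smul, re_add, im_add] <;> module
  add_smul f g Z := by
    ext1 <;> simp only [re_smul, im_smul, ComplexSmoothFunction.re_add,
      ComplexSmoothFunction.im_add, re_add, im_add] <;> module
  zero_smul Z := by ext1 <;> simp

variable [FiniteDimensional ℝ E]

instance : Bracket (ComplexVectorField I M) (ComplexVectorField I M) :=
  ⟨fun Z W => ⟨⁅Z.re, W.re⁆ - ⁅Z.im, W.im⁆, ⁅Z.re, W.im⁆ + ⁅Z.im, W.re⁆⟩⟩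

@[simp] theorem re_lie (Z W : ComplexVectorField I M) :
    ⁅Z, W⁆.re = ⁅Z.re, W.re⁆ - ⁅Z.im, W.im⁆ := rfl
@[simp] theorem im_lie (Z W : ComplexVectorField I M) :
    ⁅Z, W⁆.im = ⁅Z.re, W.im⁆ + ⁅Z.im, W.re⁆ := rfl

instance : LieRing (ComplexVectorField I M) where
  add_lie Z W U := by ext1 <;> simp <;> abel
  lie_add Z W U := by ext1 <;> simp <;> abel
  lie_self Z := by
    ext1
    · simp
    · rw [im_lie, ← lie_skew Z.re Z.im, neg_add_cancel, im_zero]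
  leibniz_lie Z W U := by
    ext1
    · simp only [re_lie, im_lie, re_add, lie_add, lie_sub, add_lie, sub_lie]
      rw [leibniz_lie Z.re W.re U.re, leibniz_lie Z.re W.im U.im, leibniz_lie Z.im W.re U.im,
        leibniz_lie Z.im W.im U.re]
      abel
    · simp only [re_lie, im_lie, im_add, lie_add, lie_sub, add_lie, sub_lie]
      rw [leibniz_lie Z.re W.re U.im, leibniz_lie Z.re W.im U.re, leibniz_lie Z.im W.re U.re,
        leibniz_lie Z.im W.im U.im]
      abel

instance : LieRingModule (ComplexVectorField I M) (ComplexSmoothFunction I M) where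
  add_lie Z W f := by
    apply ext_re_im <;> simp [add_lie] <;> abel
  lie_add Z f g := by
    apply ext_re_im <;> simp [lie_add] <;> abel
  leibniz_lie Z W f := by
    apply ext_re_im
    · change ⁅Z.re, ⁅W.re, f.re⁆ - ⁅W.im, f.im⁆⁆ - ⁅Z.im, ⁅W.re, f.im⁆ + ⁅W.im, f.re⁆⁆ =
        ⁅⁅Z.re, W.re⁆ - ⁅Z.im, W.im⁆, f.re⁆ - ⁅⁅Z.re, W.im⁆ + ⁅Z.im, W.re⁆, f.im⁆ +
        (⁅W.re, ⁅Z.re, f.re⁆ - ⁅Z.im, f.im⁆⁆ - ⁅W.im, ⁅Z.re, f.im⁆ + ⁅Z.im, f.re⁆⁆)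
      simp only [lie_add, lie_sub, add_lie, sub_lie]
      rw [leibniz_lie Z.re W.re f.re, leibniz_lie Z.re W.im f.im, leibniz_lie Z.im W.re f.im,
        leibniz_lie Z.im W.im f.re]
      abel
    · change ⁅Z.re, ⁅W.re, f.im⁆ + ⁅W.im, f.re⁆⁆ + ⁅Z.im, ⁅W.re, f.re⁆ - ⁅W.im, f.im⁆⁆ =
        ⁅⁅Z.re, W.re⁆ - ⁅Z.im, W.im⁆, f.im⁆ + ⁅⁅Z.re, W.im⁆ + ⁅Z.im, W.re⁆, f.re⁆ +
        (⁅W.re, ⁅Z.re, f.im⁆ + ⁅Z.im, f.re⁆⁆ + ⁅W.im, ⁅Z.re, f.re⁆ - ⁅Z.im, f.im⁆⁆)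
      simp only [lie_add, lie_sub, add_lie, sub_lie]
      rw [leibniz_lie Z.re W.re f.im, leibniz_lie Z.re W.im f.re, leibniz_lie Z.im W.re f.re,
        leibniz_lie Z.im W.im f.im]
      abel

instance : LieRinehartRing (ComplexSmoothFunction I M) (ComplexVectorField I M) where
  lie_smul_eq_mul' f g Z := by
    apply ext_re_im <;>
    simp only [re_lie_fun, im_lie_fun, re_smul, im_smul, re_mul, im_mul, add_lie, sub_lie,
      LieRinehartRing.lie_smul_eq_mul] <;> ring
  leibniz_mul_right' Z f g := by
    apply ext_re_im <;>
    simp only [re_lie_fun, im_lie_fun, re_mul, im_mul, lie_add, lie_sub, smul_eq_mul,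
      ComplexSmoothFunction.re_add, ComplexSmoothFunction.im_add,
      LieRinehartRing.leibniz_mul_right] <;> ring
  leibniz_smul_right' Z W f := by
    ext1 <;>
    simp only [re_lie_fun, im_lie_fun, re_smul, im_smul, re_add, im_add, re_lie, im_lie, lie_add,
      lie_sub, LieRinehartRing.leibniz_smul_right] <;> module

end ComplexVectorField
end Complex

end

end FrolicherNijenhuis

open FrolicherNijenhuis
open scoped Manifold ContDiff

namespace FrolicherNijenhuis

noncomputable section

open scoped Nat

/- Operators on forms, and their commutators with contractions. -/

section Contraction
variable {A L : Type*} [CommRing A] [AddCommGroup L] [Module A L]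

/-- The contraction `θ ↦ θ(X, …)` with a vector field, as an operator on `Ω`. -/
def contraction (X : L) : AddMonoid.End (Forms A L) :=
  DirectSum.toAddMonoid fun p =>
    match p with
    | 0 => 0
    | q + 1 => (DirectSum.of (fun p => Form A L p) q).comp
        (AddMonoidHom.mk' (fun θ : Form A L (q + 1) => θ.curryLeft X) fun θ η => by ext Z; rfl)

@[simp] theorem contraction_of_zero (X : L) (f : Form A L 0) :
    contraction X (DirectSum.of (fun p => Form A L p) 0 f) = 0 :=
  DirectSum.toAddMonoid_of _ _ _

@[simp] theorem contraction_of_succ (X : L) {q : ℕ} (θ : Form A L (q + 1)) :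
    contraction X (DirectSum.of (fun p => Form A L p) (q + 1) θ) =
      DirectSum.of (fun p => Form A L p) q (θ.curryLeft X) :=
  DirectSum.toAddMonoid_of _ _ _

theorem contraction_apply (X : L) (F : Forms A L) (p : ℕ) :
    contraction X F p = (F (p + 1)).curryLeft X := by
  induction F using DirectSum.induction_on with
  | zero => rw [map_zero]; rfl
  | add F G hF hG => rw [map_add, DirectSum.add_apply, hF, hG, DirectSum.add_apply]; rfl
  | of q θ =>
    cases q with
    | zero =>
      rw [contraction_of_zero, DirectSum.of_eq_of_ne _ _ _ (Nat.succ_ne_zero p)]; rfl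
    | succ q =>
      rw [contraction_of_succ]
      by_cases h : p = q
      · subst h; rw [DirectSum.of_eq_same, DirectSum.of_eq_same]
      · rw [DirectSum.of_eq_of_ne _ _ _ h, DirectSum.of_eq_of_ne _ _ _ (by simpa using h)]; rfl

/-- A form is zero if its component of degree `0` and its contractions are. -/
theorem forms_eq_zero {F : Forms A L} (h0 : F 0 = 0) (h : ∀ X : L, contraction X F = 0) :
    F = 0 := by
  refine DFinsupp.ext fun p => ?_
  cases p with
  | zero => exact h0
  | succ p =>
    ext Z
    have := congr($(contraction_apply (Z 0) F p) (fun i => Z i.succ))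
    rw [h] at this
    have hZ : Matrix.vecCons (Z 0) (fun i => Z i.succ) = Z := Matrix.cons_head_tail Z
    rw [AlternatingMap.curryLeft_apply_apply, hZ] at this
    exact this.symm

/-- An operator vanishes if it commutes with contractions up to a factor and its values have no
component of degree `0`. -/
theorem operator_eq_zero {P : AddMonoid.End (Forms A L)} (c : ℤ) (h0 : ∀ F, P F 0 = 0)
    (h : ∀ X : L, contraction X * P = c • (P * contraction X)) : P = 0 := by
  have h' (X : L) (F) : contraction X (P F) = c • P (contraction X F) := congr($(h X) F)
  have key (p : ℕ) (θ : Form A L p) : P (DirectSum.of (fun p => Form A L p) p θ) = 0 := by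
    induction p with
    | zero =>
      refine forms_eq_zero (h0 _) fun X => (h' X _).trans ?_
      rw [contraction_of_zero]
      exact (congrArg (c • ·) (map_zero P)).trans (smul_zero c)
    | succ q ih =>
      refine forms_eq_zero (h0 _) fun X => (h' X _).trans ?_
      rw [contraction_of_succ]
      exact (congrArg (c • ·) (ih _)).trans (smul_zero c)
  exact DirectSum.addHom_ext key

theorem contraction_add (X Y : L) :
    contraction (A := A) (X + Y) = contraction X + contraction Y := by
  refine DirectSum.addHom_ext fun p θ => ?_
  change contraction (X + Y) (DirectSum.of (fun p => Form A L p) p θ) =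
    contraction X (DirectSum.of (fun p => Form A L p) p θ) +
      contraction Y (DirectSum.of (fun p => Form A L p) p θ)
  cases p with
  | zero => simp only [contraction_of_zero, add_zero]
  | succ p => simp only [contraction_of_succ, map_add]

theorem contraction_sub (X Y : L) :
    contraction (A := A) (X - Y) = contraction X - contraction Y := by
  rw [eq_sub_iff_add_eq, ← contraction_add, sub_add_cancel]

theorem of_domDomCongr {p p' : ℕ} (h : p = p') (θ : Form A L p) :
    DirectSum.of (fun p => Form A L p) p' (θ.domDomCongr (finCongr h)) =
      DirectSum.of (fun p => Form A L p) p θ := by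
  subst h
  congr 1

end Contraction

section Ext
variable {A L : Type*} [CommRing A] [LieRing L] [Module A L] [LieRingModule L A] {n : ℕ}
variable [Algebra ℝ A] [LieRinehartRing A L]

theorem extDeriv_of_zero (f : Form A L 0) :
    extDeriv (DirectSum.of (fun p => Form A L p) 0 f) =
      DirectSum.of (fun p => Form A L p) 1 (extDerivZero f) :=
  DirectSum.toAddMonoid_of _ _ _

theorem extDeriv_of_succ (θ : Form A L (n + 1)) :
    extDeriv (DirectSum.of (fun p => Form A L p) (n + 1) θ) =
      DirectSum.of (fun p => Form A L p) (n + 2) (extDerivSucc θ) :=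
  DirectSum.toAddMonoid_of _ _ _

theorem extDeriv_apply_zero (F : Forms A L) : extDeriv F 0 = 0 := by
  induction F using DirectSum.induction_on with
  | zero => rw [map_zero]; rfl
  | add F G hF hG => rw [map_add, DirectSum.add_apply, hF, hG, add_zero]
  | of q θ =>
    cases q with
    | zero => rw [extDeriv_of_zero]; exact DirectSum.of_eq_of_ne _ _ _ (by simp)
    | succ q => rw [extDeriv_of_succ]; exact DirectSum.of_eq_of_ne _ _ _ (by simp)

/-- The exterior derivative as an element of the ring of operators. -/
def extDerivEnd : AddMonoid.End (Forms A L) := extDeriv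

/-- The Lie derivative of forms along a vector field, defined by Cartan's formula. -/
def vectorLieDerivative (X : L) : AddMonoid.End (Forms A L) :=
  contraction X * extDerivEnd + extDerivEnd * contraction X

/-- The Lie derivative of a `p`-form. -/
def lieForm (X : L) : ∀ {p : ℕ}, Form A L p → Form A L p
  | 0, f => (extDerivZero f).curryLeft X
  | 1, θ => (extDerivSucc θ).curryLeft X + extDerivZero (θ.curryLeft X)
  | _ + 2, θ => (extDerivSucc θ).curryLeft X + extDerivSucc (θ.curryLeft X)

theorem vectorLieDerivative_of (X : L) {p : ℕ} (θ : Form A L p) :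
    vectorLieDerivative X (DirectSum.of (fun p => Form A L p) p θ) =
      DirectSum.of (fun p => Form A L p) p (lieForm X θ) := by
  change contraction X (extDeriv (DirectSum.of (fun p => Form A L p) p θ)) +
    extDeriv (contraction X (DirectSum.of (fun p => Form A L p) p θ)) = _
  match p with
  | 0 => simp [extDeriv_of_zero, lieForm]
  | 1 => simp [extDeriv_of_zero, extDeriv_of_succ, lieForm]
  | p + 2 => simp [extDeriv_of_succ, lieForm]

theorem map_vecCons_removeNth (θ : Form A L (n + 1)) (j : Fin (n + 1)) (y : L)
    (Z : Fin (n + 1) → L) :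
    (-1 : ℤ) ^ (j : ℕ) • θ (Matrix.vecCons y (j.removeNth Z)) = θ (Function.update Z j y) := by
  rw [← Fin.insertNth_removeNth, AlternatingMap.map_insertNth]

theorem map_vecCons_vecCons_swap (θ : Form A L (n + 2)) (x y : L) (Z : Fin n → L) :
    θ (Matrix.vecCons x (Matrix.vecCons y Z)) = - θ (Matrix.vecCons y (Matrix.vecCons x Z)) := by
  have h := θ.map_swap (Matrix.vecCons y (Matrix.vecCons x Z)) (i := 0) (j := 1) (by simp)
  rw [← h]
  congr 1
  ext i
  refine Fin.cases (by simp) (fun i => Fin.cases (by simp) (fun i => ?_) i) i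
  rw [Function.comp_apply, Equiv.swap_apply_of_ne_of_ne] <;> simp [Fin.ext_iff]

theorem koszul_vecCons_add (θ : Form A L (n + 2)) (x : L) (Z : Fin (n + 2) → L) :
    koszul θ (Matrix.vecCons x Z) + koszul (θ.curryLeft x) Z =
      ⁅x, θ Z⁆ - ∑ i, θ (Function.update Z i ⁅x, Z i⁆) := by
  have h1 : ∀ i : Fin (n + 1), ∑ j ≥ i.succ, (-1 : ℤ) ^ (i + 1 + j : ℕ) •
          θ (Matrix.vecCons ⁅Z i.castSucc, Z j⁆
            (j.removeNth (Matrix.vecCons x (i.castSucc.removeNth Z)))) =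
      - ∑ j ≥ i, (-1 : ℤ) ^ (i + j : ℕ) • θ (Matrix.vecCons x
          (Matrix.vecCons ⁅Z i.castSucc, Z j.succ⁆ (j.removeNth (i.castSucc.removeNth Z)))) := by
    intro i
    have hs : Finset.Ici i.succ = (Finset.Ici i).map (Fin.succEmb (n + 1)) := by
      ext j
      refine Fin.cases ?_ (fun j => ?_) j <;> simp
    rw [hs, Finset.sum_map, ← Finset.sum_neg_distrib]
    refine Finset.sum_congr rfl fun j _ => ?_
    rw [Fin.coe_succEmb, removeNth_succ_vecCons, map_vecCons_vecCons_swap, smul_neg]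
    congr 2
    rw [Fin.val_succ, show (i + 1 + (j + 1) : ℕ) = i + j + 2 by ring, pow_add]
    simp
  have h2 : ∀ k : Fin (n + 2), (-1 : ℤ) ^ ((k : ℕ) + 1) •
      ⁅Z k, θ (Matrix.vecCons x (k.removeNth Z))⁆ =
      - ((-1 : ℤ) ^ (k : ℕ) • ⁅Z k, θ (Matrix.vecCons x (k.removeNth Z))⁆) := by
    intro k
    rw [pow_succ, mul_neg_one, neg_smul]
  rw [koszul_vecCons, koszul]
  simp only [h1, h2, AlternatingMap.curryLeft_apply_apply,
    map_vecCons_removeNth, Finset.sum_neg_distrib]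
  abel

theorem lieForm_apply (X : L) {p : ℕ} (θ : Form A L p) (Z : Fin p → L) :
    lieForm X θ Z = ⁅X, θ Z⁆ - ∑ i, θ (Function.update Z i ⁅X, Z i⁆) := by
  match p with
  | 0 =>
    have hZ : Z = ![] := Subsingleton.elim _ _
    subst hZ
    simp [lieForm, extDerivZero]
  | 1 =>
    change koszul θ (Matrix.vecCons X Z) + ⁅Z 0, θ (Matrix.vecCons X ![])⁆ = _
    rw [koszul_vecCons]
    have h : (0 : Fin 1).removeNth Z = ![] := Subsingleton.elim _ _
    simp only [map_vecCons_removeNth]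
    simp [h]
    abel
  | p + 2 => exact koszul_vecCons_add θ X Z

theorem vectorLieDerivative_apply_zero (X : L) (F : Forms A L) :
    (vectorLieDerivative X F) 0 = AlternatingMap.constOfIsEmpty A L (Fin 0) ⁅X, F 0 ![]⁆ := by
  ext Z
  have hZ : Z = ![] := Subsingleton.elim _ _
  subst hZ
  change _ = ⁅X, F 0 ![]⁆
  induction F using DirectSum.induction_on with
  | zero => rw [map_zero]; simp
  | add F G hF hG => simp [hF, hG]
  | of q θ =>
    rw [vectorLieDerivative_of]
    cases q with
    | zero => simp [lieForm_apply]
    | succ q =>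
      rw [DirectSum.of_eq_of_ne _ _ _ (by simp), DirectSum.of_eq_of_ne _ _ _ (by simp)]
      simp

theorem contraction_mul_vectorLieDerivative (X Y : L) :
    contraction (A := A) Y * vectorLieDerivative X =
      vectorLieDerivative X * contraction Y - contraction ⁅X, Y⁆ := by
  refine DirectSum.addHom_ext fun p θ => ?_
  change contraction Y (vectorLieDerivative X (DirectSum.of (fun p => Form A L p) p θ)) =
    vectorLieDerivative X (contraction Y (DirectSum.of (fun p => Form A L p) p θ)) -
      contraction ⁅X, Y⁆ (DirectSum.of (fun p => Form A L p) p θ)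
  rw [vectorLieDerivative_of]
  cases p with
  | zero => simp
  | succ p =>
    rw [contraction_of_succ, contraction_of_succ, contraction_of_succ, vectorLieDerivative_of,
      eq_sub_iff_add_eq, ← map_add]
    congr 1
    ext Z
    simp only [AlternatingMap.add_apply, AlternatingMap.curryLeft_apply_apply, lieForm_apply,
      Fin.sum_univ_succ, Matrix.vecCons]
    simp only [Fin.update_cons_zero, Fin.cons_update, Fin.cons_zero, Fin.cons_succ]
    abel

end Ext

section Permutations
variable {α G : Type*} [AddCommGroup G] {n : ℕ}

open Equiv.Perm in
theorem sum_perm_apply_zero [Module ℝ G] (h : Fin (n + 1) → G) :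
    ∑ σ : Equiv.Perm (Fin (n + 1)), h (σ 0) = (n ! : ℝ) • ∑ i, h i := by
  rw [← decomposeFin.symm.sum_comp, Fintype.sum_prod_type, Finset.smul_sum]
  refine Finset.sum_congr rfl fun i _ => ?_
  simp [Fintype.card_perm, Nat.cast_smul_eq_nsmul]

open Equiv.Perm in
theorem sum_perm_sign_vecCons (f : (Fin (n + 1) → α) → G) (x : α) (z : Fin n → α) :
    ∑ σ : Equiv.Perm (Fin (n + 1)), sign σ • f (Matrix.vecCons x z ∘ σ) =
      ∑ e : Equiv.Perm (Fin n), sign e • (f (Matrix.vecCons x (z ∘ e)) -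
        ∑ p : Fin n, f (Matrix.vecCons x (z ∘ e) ∘ Equiv.swap 0 p.succ)) := by
  have hc (e : Equiv.Perm (Fin n)) (p : Fin (n + 1)) :
      Matrix.vecCons x z ∘ ⇑(decomposeFin.symm (p, e))⁻¹ =
        Matrix.vecCons x (z ∘ ⇑e⁻¹) ∘ Equiv.swap 0 p := by
    have h : Matrix.vecCons x z =
        (Matrix.vecCons x (z ∘ ⇑e⁻¹) ∘ Equiv.swap 0 p) ∘ ⇑(decomposeFin.symm (p, e)) := by
      ext i
      refine Fin.cases (by simp) (fun i => by simp) i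
    rw [h, Function.comp_assoc]
    ext i
    simp
  rw [← Equiv.sum_comp (Equiv.inv (Equiv.Perm (Fin (n + 1)))), ← decomposeFin.symm.sum_comp,
    Fintype.sum_prod_type_right, ← Equiv.sum_comp (Equiv.inv (Equiv.Perm (Fin n)))]
  refine Finset.sum_congr rfl fun e _ => ?_
  simp only [Equiv.inv_apply, hc, sign_inv, decomposeFin.symm_sign, Fin.sum_univ_succ, inv_inv]
  simp [sub_eq_add_neg, smul_add, Finset.smul_sum]

end Permutations

section Insertion
variable {A L : Type*} [CommRing A] [AddCommGroup L] [Module A L] {m q : ℕ} [Algebra ℝ A]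

/-- The insertion operator as an element of the ring of operators. -/
def insertionEnd (K : VectorForm A L m) : AddMonoid.End (Forms A L) := insertion K

@[simp] theorem insertionEnd_of_zero (K : VectorForm A L m) (f : Form A L 0) :
    insertionEnd K (DirectSum.of (fun p => Form A L p) 0 f) = 0 :=
  DirectSum.toAddMonoid_of _ _ _

theorem insertionEnd_of_succ (K : VectorForm A L m) (θ : Form A L (q + 1)) :
    insertionEnd K (DirectSum.of (fun p => Form A L p) (q + 1) θ) =
      DirectSum.of (fun p => Form A L p) (m + q) (insertionSucc K θ) :=
  DirectSum.toAddMonoid_of _ _ _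

theorem insertionEnd_apply_zero (K : VectorForm A L (m + 1)) (F : Forms A L) :
    (insertionEnd K F) 0 = 0 := by
  induction F using DirectSum.induction_on with
  | zero => rw [map_zero]; rfl
  | add F G hF hG => rw [map_add, DirectSum.add_apply, hF, hG, add_zero]
  | of q θ =>
    cases q with
    | zero => rw [insertionEnd_of_zero]; rfl
    | succ q => rw [insertionEnd_of_succ]; exact DirectSum.of_eq_of_ne _ _ _ (by omega)

theorem insertionSucc_apply (K : VectorForm A L m) (θ : Form A L (q + 1)) (Z : Fin (m + q) → L) :
    insertionSucc K θ Z = ((m ! * q ! : ℝ)⁻¹) • ∑ σ : Equiv.Perm (Fin (m + q)),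
      Equiv.Perm.sign σ • θ (Matrix.vecCons (K fun i => Z (σ (Fin.castAdd q i)))
        fun j => Z (σ (Fin.natAdd m j))) := by
  simp only [insertionSucc, AlternatingMap.smul_apply, MultilinearMap.alternatization_apply]
  rfl

theorem insertionSucc_add (K K' : VectorForm A L m) (θ : Form A L (q + 1)) :
    insertionSucc (K + K') θ = insertionSucc K θ + insertionSucc K' θ := by
  ext Z
  have h (x y : L) (Z : Fin q → L) : θ (Matrix.vecCons (x + y) Z) =
      θ (Matrix.vecCons x Z) + θ (Matrix.vecCons y Z) := θ.toMultilinearMap.cons_add _ _ _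
  simp only [insertionSucc_apply, AlternatingMap.add_apply, h, smul_add, Finset.sum_add_distrib]

theorem insertionEnd_add (K K' : VectorForm A L m) :
    insertionEnd (K + K') = insertionEnd K + insertionEnd K' := by
  refine DirectSum.addHom_ext fun p θ => ?_
  change insertionEnd (K + K') (DirectSum.of (fun p => Form A L p) p θ) =
    insertionEnd K (DirectSum.of (fun p => Form A L p) p θ) +
      insertionEnd K' (DirectSum.of (fun p => Form A L p) p θ)
  cases p with
  | zero => simp only [insertionEnd_of_zero, add_zero]
  | succ p => simp only [insertionEnd_of_succ, insertionSucc_add, map_add]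

theorem insertionEnd_zero : insertionEnd (0 : VectorForm A L m) = 0 := by
  rw [← add_eq_left (a := insertionEnd (0 : VectorForm A L m)), ← insertionEnd_add, add_zero]

theorem insertionEnd_neg (K : VectorForm A L m) : insertionEnd (-K) = -insertionEnd K := by
  rw [eq_neg_iff_add_eq_zero, ← insertionEnd_add, neg_add_cancel, insertionEnd_zero]

theorem insertionSucc_domDomCongr_apply (K : VectorForm A L m) (θ : Form A L (q + 1)) {p : ℕ}
    (h : m + q = p) (Z : Fin p → L) :
    (insertionSucc K θ).domDomCongr (finCongr h) Z =
      ((m ! * q ! : ℝ)⁻¹) • ∑ σ : Equiv.Perm (Fin p),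
        Equiv.Perm.sign σ • θ (Matrix.vecCons (K fun i => Z (σ (Fin.cast h (Fin.castAdd q i))))
          fun j => Z (σ (Fin.cast h (Fin.natAdd m j)))) := by
  subst h
  exact insertionSucc_apply K θ Z

/-- The action of an endomorphism on `p`-forms as a derivation. -/
def derivationForm (B : L →ₗ[A] L) : ∀ {p : ℕ}, Form A L p → Form A L p
  | 0, _ => 0
  | q + 1, θ => (insertionSucc (AlternatingMap.ofSubsingleton A L L (0 : Fin 1) B) θ).domDomCongr
      (finCongr (Nat.add_comm 1 q))

theorem derivationForm_eq_sum_perm (B : L →ₗ[A] L) (θ : Form A L (q + 1)) (Z : Fin (q + 1) → L) :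
    derivationForm B θ Z = ((q ! : ℝ)⁻¹) • ∑ σ : Equiv.Perm (Fin (q + 1)),
      Equiv.Perm.sign σ • θ (Matrix.vecCons (B ((Z ∘ σ) 0)) fun j => (Z ∘ σ) j.succ) := by
  rw [derivationForm, insertionSucc_domDomCongr_apply, Nat.factorial_one, Nat.cast_one, one_mul]
  have hs (j : Fin q) : Fin.cast (Nat.add_comm 1 q) (Fin.natAdd 1 j) = j.succ := by
    ext; simp
  simp only [hs]
  rfl

theorem derivationForm_apply (B : L →ₗ[A] L) {p : ℕ} (θ : Form A L p) (Z : Fin p → L) :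
    derivationForm B θ Z = ∑ i, θ (Function.update Z i (B (Z i))) := by
  cases p with
  | zero => simp [derivationForm]
  | succ q =>
    have h (σ : Equiv.Perm (Fin (q + 1))) : Equiv.Perm.sign σ • θ (Matrix.vecCons
        (B ((Z ∘ σ) 0)) fun j => (Z ∘ σ) j.succ) = θ (Function.update Z (σ 0) (B (Z (σ 0)))) := by
      have hZ : Matrix.vecCons (B ((Z ∘ σ) 0)) (fun j => (Z ∘ σ) j.succ) =
          Function.update Z (σ 0) (B (Z (σ 0))) ∘ σ := by
        ext i
        refine Fin.cases (by simp) (fun i => ?_) i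
        simp
      rw [hZ, AlternatingMap.map_perm, smul_smul, Int.units_mul_self, one_smul]
    have hq := sum_perm_apply_zero fun i => θ (Function.update Z i (B (Z i)))
    have hq0 : (q ! : ℝ) ≠ 0 := by exact_mod_cast q.factorial_ne_zero
    rw [eq_comm, ← eq_inv_smul_iff₀ hq0] at hq
    rw [hq, derivationForm_eq_sum_perm]
    simp only [h]

theorem insertionEnd_ofSubsingleton_of (B : L →ₗ[A] L) {p : ℕ} (θ : Form A L p) :
    insertionEnd (AlternatingMap.ofSubsingleton A L L (0 : Fin 1) B)
      (DirectSum.of (fun p => Form A L p) p θ) =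
      DirectSum.of (fun p => Form A L p) p (derivationForm B θ) := by
  cases p with
  | zero => simp [derivationForm]
  | succ q => rw [insertionEnd_of_succ, derivationForm, of_domDomCongr]

theorem contraction_mul_insertionEnd_ofSubsingleton (B : L →ₗ[A] L) (X : L) :
    contraction X * insertionEnd (AlternatingMap.ofSubsingleton A L L (0 : Fin 1) B) =
      contraction (B X) +
        insertionEnd (AlternatingMap.ofSubsingleton A L L (0 : Fin 1) B) * contraction X := by
  refine DirectSum.addHom_ext fun p θ => ?_
  change contraction X (insertionEnd _ (DirectSum.of (fun p => Form A L p) p θ)) =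
    contraction (B X) (DirectSum.of (fun p => Form A L p) p θ) +
      insertionEnd _ (contraction X (DirectSum.of (fun p => Form A L p) p θ))
  rw [insertionEnd_ofSubsingleton_of]
  cases p with
  | zero => simp
  | succ p =>
    simp only [contraction_of_succ, insertionEnd_ofSubsingleton_of, ← map_add]
    congr 1
    ext Z
    simp only [AlternatingMap.add_apply, AlternatingMap.curryLeft_apply_apply,
      derivationForm_apply, Fin.sum_univ_succ, Matrix.vecCons, Fin.update_cons_zero,
      Fin.cons_update, Fin.cons_zero, Fin.cons_succ]

/-- The insertion of a vector-valued `2`-form in a `(q + 1)`-form, as a `(q + 2)`-form. -/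
def insertionTwo (T : VectorForm A L 2) (θ : Form A L (q + 1)) : Form A L (q + 2) :=
  (insertionSucc T θ).domDomCongr (finCongr (Nat.add_comm 2 q))

theorem insertionTwo_apply (T : VectorForm A L 2) (θ : Form A L (q + 1)) (Z : Fin (q + 2) → L) :
    insertionTwo T θ Z = ((2 * q ! : ℝ)⁻¹) • ∑ σ : Equiv.Perm (Fin (q + 2)),
      Equiv.Perm.sign σ • θ (Matrix.vecCons (T ![(Z ∘ σ) 0, (Z ∘ σ) 1])
        fun j => (Z ∘ σ) j.succ.succ) := by
  rw [insertionTwo, insertionSucc_domDomCongr_apply, Nat.factorial_two, Nat.cast_two]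
  have hs (j : Fin q) : Fin.cast (Nat.add_comm 2 q) (Fin.natAdd 2 j) = j.succ.succ := by
    ext; simp only [Fin.val_cast, Fin.val_natAdd, Fin.val_succ]; omega
  have ht (σ : Equiv.Perm (Fin (q + 2))) :
      (fun i => Z (σ (Fin.cast (Nat.add_comm 2 q) (Fin.castAdd q i)))) =
        ![(Z ∘ σ) 0, (Z ∘ σ) 1] := by
    ext i
    fin_cases i <;> rfl
  simp only [hs, ht]
  rfl

theorem insertionEnd_two_of_succ (T : VectorForm A L 2) (θ : Form A L (q + 1)) :
    insertionEnd T (DirectSum.of (fun p => Form A L p) (q + 1) θ) =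
      DirectSum.of (fun p => Form A L p) (q + 2) (insertionTwo T θ) := by
  rw [insertionEnd_of_succ, insertionTwo, of_domDomCongr]

/-- The endomorphism `Y ↦ T(X, Y)`. -/
def evalFirst (T : VectorForm A L 2) (X : L) : L →ₗ[A] L :=
  (AlternatingMap.ofSubsingleton A L L (0 : Fin 1)).symm (T.curryLeft X)

@[simp] theorem evalFirst_apply (T : VectorForm A L 2) (X Y : L) :
    evalFirst T X Y = T ![X, Y] := by
  change T (Matrix.vecCons X fun _ => Y) = _
  congr 1
  ext i
  fin_cases i <;> rfl

theorem vectorForm_two_swap (T : VectorForm A L 2) (X Y : L) : T ![X, Y] = - T ![Y, X] := by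
  rw [← T.map_swap ![Y, X] (i := 0) (j := 1) (by simp)]
  congr 1
  ext i
  fin_cases i <;> simp

theorem insertionTwo_vecCons (T : VectorForm A L 2) (θ : Form A L (q + 1)) (X : L)
    (Z : Fin (q + 1) → L) (g : (Fin (q + 2) → L) → A)
    (hg : ∀ V, g V = θ (Matrix.vecCons (T ![V 0, V 1]) fun j => V j.succ.succ)) :
    insertionTwo T θ (Matrix.vecCons X Z) = derivationForm (evalFirst T X) θ Z -
      ((2 * q ! : ℝ)⁻¹) • ∑ k : Fin q, ∑ e : Equiv.Perm (Fin (q + 1)), Equiv.Perm.sign e •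
        g (Matrix.vecCons X (Z ∘ e) ∘ Equiv.swap 0 k.succ.succ) := by
  have h1 (Y : Fin (q + 1) → L) :
      θ (Matrix.vecCons (evalFirst T X (Y 0)) fun j => Y j.succ) = g (Matrix.vecCons X Y) := by
    rw [hg, evalFirst_apply]; rfl
  have h2 (Y : Fin (q + 1) → L) :
      g (Matrix.vecCons X Y ∘ Equiv.swap 0 (Fin.succ 0)) = - g (Matrix.vecCons X Y) := by
    have hx (x : L) (Z : Fin q → L) : θ (Matrix.vecCons (-x) Z) = - θ (Matrix.vecCons x Z) := by
      have := θ.toMultilinearMap.cons_smul Z (-1) x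
      simpa using! this
    rw [hg, hg, ← hx, ← vectorForm_two_swap]
    congr 2
  have hc : ((q ! : ℝ)⁻¹) = (2 * q ! : ℝ)⁻¹ * 2 := by
    rw [mul_inv]; ring
  rw [insertionTwo_apply, derivationForm_eq_sum_perm]
  simp only [h1, ← hg]
  rw [sum_perm_sign_vecCons, Finset.sum_comm, hc, mul_smul, ← smul_sub]
  congr 1
  rw [Finset.smul_sum, ← Finset.sum_sub_distrib]
  refine Finset.sum_congr rfl fun e _ => ?_
  rw [Fin.sum_univ_succ, h2, ← Finset.smul_sum, two_smul, ← smul_add, ← smul_sub]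
  abel_nf

theorem sum_perm_swap_eq (T : VectorForm A L 2) (θ : Form A L (q + 2)) (X : L)
    (Z : Fin (q + 2) → L) (g : (Fin (q + 3) → L) → A)
    (hg : ∀ V, g V = θ (Matrix.vecCons (T ![V 0, V 1]) fun j => V j.succ.succ)) (k : Fin (q + 1)) :
    ∑ e : Equiv.Perm (Fin (q + 2)), Equiv.Perm.sign e •
        g (Matrix.vecCons X (Z ∘ e) ∘ Equiv.swap 0 k.succ.succ) =
      ∑ e : Equiv.Perm (Fin (q + 2)), Equiv.Perm.sign e •
        θ (Matrix.vecCons X (Matrix.vecCons (T ![(Z ∘ e) 0, (Z ∘ e) 1])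
          fun j => (Z ∘ e) j.succ.succ)) := by
  have h0 (Y : Fin (q + 2) → L) :
      g (Matrix.vecCons X Y ∘ Equiv.swap 0 (Fin.succ (Fin.succ 0))) =
        θ (Matrix.vecCons X (Matrix.vecCons (T ![Y 0, Y 1]) fun j => Y j.succ.succ)) := by
    have hx (x : L) (Z : Fin (q + 1) → L) :
        θ (Matrix.vecCons (-x) Z) = - θ (Matrix.vecCons x Z) := by
      have := θ.toMultilinearMap.cons_smul Z (-1) x
      simpa using! this
    have hz (x y : L) (Z : Fin q → L) :
        θ (Matrix.vecCons x (Matrix.vecCons y Z)) =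
          - θ (Matrix.vecCons y (Matrix.vecCons x Z)) := by
      have h := θ.map_swap (Matrix.vecCons y (Matrix.vecCons x Z)) (i := 0) (j := 1) (by simp)
      rw [← h]
      congr 1
      ext i
      refine Fin.cases (by simp) (fun i => Fin.cases (by simp) (fun i => ?_) i) i
      rw [Function.comp_apply, Equiv.swap_apply_of_ne_of_ne] <;> simp [Fin.ext_iff]
    rw [hg, hz, ← hx, ← vectorForm_two_swap]
    congr 2
    ext j
    refine Fin.cases (by simp) (fun j => ?_) j
    rw [Function.comp_apply, Equiv.swap_apply_of_ne_of_ne (Fin.succ_ne_zero _) fun h =>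
      Fin.succ_ne_zero j (Fin.succ_injective _ (Fin.succ_injective _ h))]
    rfl
  simp only [← h0]
  by_cases hk : k = 0
  · rw [hk]
  have hk' : Fin.succ 0 ≠ k.succ := fun h => hk (Fin.succ_injective _ h).symm
  rw [← Equiv.sum_comp (Equiv.mulRight (Equiv.swap (Fin.succ 0) k.succ))]
  refine Finset.sum_congr rfl fun e _ => ?_
  have hV (V : Fin (q + 3) → L) :
      g (V ∘ Equiv.swap (Fin.succ (Fin.succ 0)) k.succ.succ) = - g V := by
    rw [hg, hg, ← θ.map_swap _ (i := Fin.succ 0) (j := k.succ) hk']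
    have h (j : Fin (q + 2)) : (V ∘ Equiv.swap (Fin.succ (Fin.succ 0))
        k.succ.succ) (Fin.succ j) = V (Fin.succ (Equiv.swap (Fin.succ 0) k.succ j)) := by
      rw [Function.comp_apply, ← (Fin.succ_injective _).map_swap]
    have h' : (V ∘ Equiv.swap (Fin.succ (Fin.succ 0)) k.succ.succ) 0 = V 0 := by
      rw [Function.comp_apply, Equiv.swap_apply_of_ne_of_ne (Fin.succ_ne_zero _).symm
        (Fin.succ_ne_zero _).symm]
    have h1 : Equiv.swap (Fin.succ 0) k.succ 0 = 0 := Equiv.swap_apply_of_ne_of_ne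
      (Fin.succ_ne_zero _).symm (Fin.succ_ne_zero _).symm
    congr 1
    ext i
    refine Fin.cases ?_ (fun i => ?_) i
    · refine Eq.trans ?_ (congrArg (Matrix.vecCons (T ![V 0, V 1]) fun j => V j.succ.succ) h1.symm)
      rw [h', ← Fin.succ_zero_eq_one, h, h1]
      rfl
    · refine Eq.trans ?_ (congrArg (Matrix.vecCons (T ![V 0, V 1]) fun j => V j.succ.succ)
        ((Fin.succ_injective _).map_swap _ _ i))
      simp only [Matrix.cons_val_succ]
      rw [(Fin.succ_injective _).map_swap]
      exact h i.succ
  have hc : Matrix.vecCons X (Z ∘ ⇑(e * Equiv.swap (Fin.succ 0) k.succ)) ∘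
      Equiv.swap 0 k.succ.succ = (Matrix.vecCons X (Z ∘ e) ∘ Equiv.swap 0 (Fin.succ (Fin.succ 0))) ∘
        Equiv.swap (Fin.succ (Fin.succ 0)) k.succ.succ := by
    have hs : Matrix.vecCons X (Z ∘ ⇑(e * Equiv.swap (Fin.succ 0) k.succ)) =
        Matrix.vecCons X (Z ∘ e) ∘ Equiv.swap (Fin.succ (Fin.succ 0)) k.succ.succ := by
      ext i
      refine Fin.cases ?_ (fun i => ?_) i
      · rw [Function.comp_apply, Equiv.swap_apply_of_ne_of_ne (Fin.succ_ne_zero _).symm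
          (Fin.succ_ne_zero _).symm]
        rfl
      · rw [Function.comp_apply, ← (Fin.succ_injective _).map_swap]
        rfl
    have hm := Equiv.mul_swap_eq_swap_mul (Equiv.swap (Fin.succ (Fin.succ 0)) k.succ.succ) 0
      k.succ.succ
    rw [Equiv.swap_apply_right, Equiv.swap_apply_of_ne_of_ne (Fin.succ_ne_zero _).symm
      (Fin.succ_ne_zero _).symm] at hm
    rw [hs, Function.comp_assoc, Function.comp_assoc, ← Equiv.Perm.coe_mul, ← Equiv.Perm.coe_mul,
      hm]
  rw [Equiv.coe_mulRight, hc, hV, Equiv.Perm.sign_mul, Equiv.Perm.sign_swap hk']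
  simp

theorem contraction_mul_insertionEnd_two (T : VectorForm A L 2) (X : L) :
    contraction X * insertionEnd T =
      insertionEnd (AlternatingMap.ofSubsingleton A L L (0 : Fin 1) (evalFirst T X)) -
        insertionEnd T * contraction X := by
  refine DirectSum.addHom_ext fun p θ => ?_
  change contraction X (insertionEnd T (DirectSum.of (fun p => Form A L p) p θ)) =
    insertionEnd _ (DirectSum.of (fun p => Form A L p) p θ) -
      insertionEnd T (contraction X (DirectSum.of (fun p => Form A L p) p θ))
  rw [insertionEnd_ofSubsingleton_of, eq_sub_iff_add_eq]
  match p with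
  | 0 => simp [derivationForm]
  | 1 =>
    rw [insertionEnd_two_of_succ, contraction_of_succ, contraction_of_succ, insertionEnd_of_zero,
      add_zero]
    congr 1
    ext Z
    rw [AlternatingMap.curryLeft_apply_apply, insertionTwo_vecCons T θ X Z _ fun V => rfl]
    simp
  | q + 2 =>
    rw [insertionEnd_two_of_succ, contraction_of_succ, contraction_of_succ,
      insertionEnd_two_of_succ, ← map_add]
    congr 1
    ext Z
    have hq : (((q + 1 : ℕ) : ℝ) + 1) ≠ 0 := by positivity
    rw [AlternatingMap.add_apply, AlternatingMap.curryLeft_apply_apply,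
      insertionTwo_vecCons T θ X Z _ fun V => rfl, insertionTwo_apply]
    simp only [sum_perm_swap_eq T θ X Z _ fun V => rfl, AlternatingMap.curryLeft_apply_apply]
    rw [Finset.sum_const, Finset.card_univ, Fintype.card_fin, ← Nat.cast_smul_eq_nsmul ℝ, smul_smul,
      Nat.factorial_succ]
    have hc : (2 * ((q + 1) * q ! : ℕ) : ℝ)⁻¹ * ((q + 1 : ℕ) : ℝ) = (2 * q ! : ℝ)⁻¹ := by
      have := q.factorial_ne_zero
      push_cast
      field_simp
    rw [hc, sub_add_cancel]

end Insertion

section Ext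
variable {A L : Type*} [CommRing A] [LieRing L] [Module A L] [LieRingModule L A]
variable [Algebra ℝ A] [LieRinehartRing A L]

/-- The insertion operator of an endomorphism. -/
def endInsertion (B : L →ₗ[A] L) : AddMonoid.End (Forms A L) := insertionEnd (endForm B)

theorem contraction_mul_extDerivEnd (X : L) :
    contraction (A := A) X * extDerivEnd =
      vectorLieDerivative X - extDerivEnd * contraction X := by
  rw [vectorLieDerivative, add_sub_cancel_right]

theorem contraction_mul_endInsertion (B : L →ₗ[A] L) (X : L) :
    contraction X * endInsertion B = contraction (B X) + endInsertion B * contraction X :=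
  contraction_mul_insertionEnd_ofSubsingleton B X

theorem contraction_mul_insertionEnd (T : VectorForm A L 2) (X : L) :
    contraction X * insertionEnd T =
      endInsertion (evalFirst T X) - insertionEnd T * contraction X :=
  contraction_mul_insertionEnd_two T X

/-- The Lie derivative of an endomorphism along a vector field: `Y ↦ [X, BY] - B[X, Y]`. -/
def lieEnd (X : L) (B : L →ₗ[A] L) : L →ₗ[A] L where
  toFun Y := ⁅X, B Y⁆ - B ⁅X, Y⁆
  map_add' Y Z := by simp only [map_add, lie_add]; abel
  map_smul' a Y := by
    simp only [map_smul, map_add, LieRinehartRing.leibniz_smul_right, RingHom.id_apply]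
    module

@[simp] theorem lieEnd_apply (X Y : L) (B : L →ₗ[A] L) :
    lieEnd X B Y = ⁅X, B Y⁆ - B ⁅X, Y⁆ := rfl

/-- The Lie derivative along an endomorphism. -/
def endLieDerivative (B : L →ₗ[A] L) : AddMonoid.End (Forms A L) :=
  endInsertion B * extDerivEnd - extDerivEnd * endInsertion B

theorem extDerivEnd_apply_zero (F : Forms A L) : (extDerivEnd F) 0 = 0 :=
  extDeriv_apply_zero F

theorem endInsertion_apply_zero (B : L →ₗ[A] L) (F : Forms A L) : (endInsertion B F) 0 = 0 :=
  insertionEnd_apply_zero _ F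

theorem vectorLieDerivative_apply_zero_of {X : L} {F : Forms A L} (h : F 0 = 0) :
    (vectorLieDerivative X F) 0 = 0 := by
  rw [vectorLieDerivative_apply_zero, h, AlternatingMap.zero_apply, lie_zero]
  rfl

theorem endLieDerivative_apply_zero (B : L →ₗ[A] L) (F : Forms A L) :
    (endLieDerivative B F) 0 = 0 := by
  change (endInsertion B (extDerivEnd F) - extDerivEnd (endInsertion B F)) 0 = 0
  rw [DirectSum.sub_apply, endInsertion_apply_zero, zero_sub, neg_eq_zero]
  exact extDerivEnd_apply_zero _

theorem vectorLieDerivative_lie (X Y : L) : vectorLieDerivative (A := A) ⁅X, Y⁆ =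
    vectorLieDerivative X * vectorLieDerivative Y -
      vectorLieDerivative Y * vectorLieDerivative X := by
  rw [← sub_eq_zero]
  refine operator_eq_zero 1 (fun F => ?_) fun Z => ?_
  · change (vectorLieDerivative ⁅X, Y⁆ F - (vectorLieDerivative X (vectorLieDerivative Y F) -
      vectorLieDerivative Y (vectorLieDerivative X F))) 0 = 0
    simp only [DirectSum.sub_apply, vectorLieDerivative_apply_zero,
      AlternatingMap.constOfIsEmpty_apply, Function.const_apply, lie_lie]
    ext Z
    simp
  · have h (U V : L) : contraction (A := A) Z * (vectorLieDerivative U * vectorLieDerivative V) =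
        vectorLieDerivative U * vectorLieDerivative V * contraction Z -
          vectorLieDerivative U * contraction ⁅V, Z⁆ -
            (vectorLieDerivative V * contraction ⁅U, Z⁆ - contraction ⁅V, ⁅U, Z⁆⁆) := by
      rw [← mul_assoc, contraction_mul_vectorLieDerivative, sub_mul, mul_assoc,
        contraction_mul_vectorLieDerivative, contraction_mul_vectorLieDerivative]
      noncomm_ring
    rw [one_smul, mul_sub, mul_sub, h, h, contraction_mul_vectorLieDerivative, lie_lie,
      contraction_sub]
    noncomm_ring

theorem vectorLieDerivative_mul_extDerivEnd (X : L) :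
    vectorLieDerivative (A := A) X * extDerivEnd = extDerivEnd * vectorLieDerivative X := by
  rw [← sub_eq_zero]
  refine operator_eq_zero (-1) (fun F => ?_) fun Y => ?_
  · change (vectorLieDerivative X (extDerivEnd F) - extDerivEnd (vectorLieDerivative X F)) 0 = 0
    rw [DirectSum.sub_apply, vectorLieDerivative_apply_zero_of (extDerivEnd_apply_zero F), zero_sub,
      neg_eq_zero]
    exact extDerivEnd_apply_zero _
  · have h1 : contraction (A := A) Y * (vectorLieDerivative X * extDerivEnd) =
        vectorLieDerivative X * (vectorLieDerivative Y - extDerivEnd * contraction Y) -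
          (vectorLieDerivative ⁅X, Y⁆ - extDerivEnd * contraction ⁅X, Y⁆) := by
      rw [← mul_assoc, contraction_mul_vectorLieDerivative, sub_mul, mul_assoc,
        contraction_mul_extDerivEnd, contraction_mul_extDerivEnd]
    have h2 : contraction (A := A) Y * (extDerivEnd * vectorLieDerivative X) =
        vectorLieDerivative Y * vectorLieDerivative X -
          extDerivEnd * (vectorLieDerivative X * contraction Y - contraction ⁅X, Y⁆) := by
      rw [← mul_assoc, contraction_mul_extDerivEnd, sub_mul, mul_assoc,
        contraction_mul_vectorLieDerivative]
    rw [mul_sub, h1, h2, vectorLieDerivative_lie]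
    noncomm_ring

theorem vectorLieDerivative_mul_endInsertion (X : L) (B : L →ₗ[A] L) :
    vectorLieDerivative X * endInsertion B =
      endInsertion B * vectorLieDerivative X + endInsertion (lieEnd X B) := by
  rw [← sub_eq_zero]
  refine operator_eq_zero 1 (fun F => ?_) fun Y => ?_
  · change (vectorLieDerivative X (endInsertion B F) - (endInsertion B (vectorLieDerivative X F) +
      endInsertion (lieEnd X B) F)) 0 = 0
    rw [DirectSum.sub_apply, DirectSum.add_apply,
      vectorLieDerivative_apply_zero_of (endInsertion_apply_zero B F), endInsertion_apply_zero,
      endInsertion_apply_zero, add_zero, sub_zero]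
  · have h1 : contraction Y * (vectorLieDerivative X * endInsertion B) =
        vectorLieDerivative X * (contraction (B Y) + endInsertion B * contraction Y) -
          (contraction (B ⁅X, Y⁆) + endInsertion B * contraction ⁅X, Y⁆) := by
      rw [← mul_assoc, contraction_mul_vectorLieDerivative, sub_mul, mul_assoc,
        contraction_mul_endInsertion, contraction_mul_endInsertion]
    have h2 : contraction Y * (endInsertion B * vectorLieDerivative X) =
        (vectorLieDerivative X * contraction (B Y) - contraction ⁅X, B Y⁆) +
          endInsertion B * (vectorLieDerivative X * contraction Y - contraction ⁅X, Y⁆) := by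
      rw [← mul_assoc, contraction_mul_endInsertion, add_mul, mul_assoc,
        contraction_mul_vectorLieDerivative, contraction_mul_vectorLieDerivative]
    rw [mul_sub, mul_add, h1, h2, contraction_mul_endInsertion, lieEnd_apply, contraction_sub]
    noncomm_ring

theorem endInsertion_mul_endInsertion (B C : L →ₗ[A] L) :
    endInsertion B * endInsertion C =
      endInsertion C * endInsertion B + endInsertion (C ∘ₗ B - B ∘ₗ C) := by
  rw [← sub_eq_zero]
  refine operator_eq_zero 1 (fun F => ?_) fun Y => ?_
  · change (endInsertion B (endInsertion C F) - (endInsertion C (endInsertion B F) +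
      endInsertion (C ∘ₗ B - B ∘ₗ C) F)) 0 = 0
    rw [DirectSum.sub_apply, DirectSum.add_apply]
    simp only [endInsertion_apply_zero, add_zero, sub_zero]
  · have h (B C : L →ₗ[A] L) : contraction Y * (endInsertion B * endInsertion C) =
        (contraction (C (B Y)) + endInsertion C * contraction (B Y)) +
          endInsertion B * (contraction (C Y) + endInsertion C * contraction Y) := by
      rw [← mul_assoc, contraction_mul_endInsertion, add_mul, mul_assoc,
        contraction_mul_endInsertion, contraction_mul_endInsertion]
    rw [mul_sub, mul_add, h, h, contraction_mul_endInsertion, LinearMap.sub_apply, contraction_sub,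
      LinearMap.comp_apply, LinearMap.comp_apply]
    noncomm_ring

theorem endInsertion_add (B C : L →ₗ[A] L) :
    endInsertion (B + C) = endInsertion B + endInsertion C := by
  rw [endInsertion, endInsertion, endInsertion, ← insertionEnd_add]
  congr 1

theorem endInsertion_sub (B C : L →ₗ[A] L) :
    endInsertion (B - C) = endInsertion B - endInsertion C := by
  rw [eq_sub_iff_add_eq, ← endInsertion_add, sub_add_cancel]

theorem endLieDerivative_sub (B C : L →ₗ[A] L) :
    endLieDerivative (B - C) = endLieDerivative B - endLieDerivative C := by
  rw [endLieDerivative, endLieDerivative, endLieDerivative, endInsertion_sub]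
  noncomm_ring

theorem contraction_mul_endLieDerivative (B : L →ₗ[A] L) (X : L) :
    contraction X * endLieDerivative B = vectorLieDerivative (B X) - endInsertion (lieEnd X B) -
      endLieDerivative B * contraction X := by
  have h1 : contraction X * (endInsertion B * extDerivEnd) =
      vectorLieDerivative (B X) - extDerivEnd * contraction (B X) +
        endInsertion B * (vectorLieDerivative X - extDerivEnd * contraction X) := by
    rw [← mul_assoc, contraction_mul_endInsertion, add_mul, mul_assoc,
      contraction_mul_extDerivEnd, contraction_mul_extDerivEnd]
  have h2 : contraction X * (extDerivEnd * endInsertion B) =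
      vectorLieDerivative X * endInsertion B -
        extDerivEnd * (contraction (B X) + endInsertion B * contraction X) := by
    rw [← mul_assoc, contraction_mul_extDerivEnd, sub_mul, mul_assoc, contraction_mul_endInsertion]
  rw [endLieDerivative, mul_sub, h1, h2, vectorLieDerivative_mul_endInsertion]
  noncomm_ring

theorem vectorLieDerivative_mul_endLieDerivative (X : L) (B : L →ₗ[A] L) :
    vectorLieDerivative X * endLieDerivative B =
      endLieDerivative B * vectorLieDerivative X + endLieDerivative (lieEnd X B) := by
  have h1 : vectorLieDerivative X * (endInsertion B * extDerivEnd) =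
      endInsertion B * (extDerivEnd * vectorLieDerivative X) +
        endInsertion (lieEnd X B) * extDerivEnd := by
    rw [← mul_assoc, vectorLieDerivative_mul_endInsertion, add_mul, mul_assoc,
      vectorLieDerivative_mul_extDerivEnd]
  have h2 : vectorLieDerivative X * (extDerivEnd * endInsertion B) =
      extDerivEnd * (endInsertion B * vectorLieDerivative X + endInsertion (lieEnd X B)) := by
    rw [← mul_assoc, vectorLieDerivative_mul_extDerivEnd, mul_assoc,
      vectorLieDerivative_mul_endInsertion]
  rw [endLieDerivative, mul_sub, h1, h2, endLieDerivative]
  noncomm_ring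

theorem contraction_mul_comm_endInsertion_endLieDerivative (B N : L →ₗ[A] L) (X : L) :
    contraction X * (endInsertion B * endLieDerivative N - endLieDerivative N * endInsertion B) =
      vectorLieDerivative (N (B X)) - (endInsertion (lieEnd (B X) N) +
        endInsertion (lieEnd (N X) B) + endInsertion (lieEnd X N ∘ₗ B - B ∘ₗ lieEnd X N)) -
      (endInsertion B * endLieDerivative N - endLieDerivative N * endInsertion B) *
        contraction X := by
  have h1 : contraction X * (endInsertion B * endLieDerivative N) =
      vectorLieDerivative (N (B X)) - endInsertion (lieEnd (B X) N) -
        endLieDerivative N * contraction (B X) + (endInsertion B * vectorLieDerivative (N X) -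
          endInsertion B * endInsertion (lieEnd X N) -
            endInsertion B * endLieDerivative N * contraction X) := by
    rw [← mul_assoc, contraction_mul_endInsertion, add_mul, mul_assoc,
      contraction_mul_endLieDerivative, contraction_mul_endLieDerivative]
    noncomm_ring
  have h2 : contraction X * (endLieDerivative N * endInsertion B) =
      vectorLieDerivative (N X) * endInsertion B - endInsertion (lieEnd X N) * endInsertion B -
        endLieDerivative N * (contraction (B X) + endInsertion B * contraction X) := by
    rw [← mul_assoc, contraction_mul_endLieDerivative, sub_mul, sub_mul, mul_assoc,
      contraction_mul_endInsertion]
  rw [mul_sub, h1, h2, vectorLieDerivative_mul_endInsertion,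
    endInsertion_mul_endInsertion B (lieEnd X N)]
  noncomm_ring

theorem torsion_apply (N : L →ₗ[A] L) (Z : Fin 2 → L) : torsion N Z =
    ⁅N (Z 0), N (Z 1)⁆ - N ⁅N (Z 0), Z 1⁆ - N ⁅Z 0, N (Z 1)⁆ + N (N ⁅Z 0, Z 1⁆) := rfl

theorem evalFirst_torsion (N : L →ₗ[A] L) (X : L) :
    evalFirst (torsion N) X = lieEnd (N X) N - N ∘ₗ lieEnd X N := by
  ext Y
  simp only [evalFirst_apply, torsion_apply, LinearMap.sub_apply, LinearMap.comp_apply,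
    lieEnd_apply, map_sub, Matrix.cons_val_zero, Matrix.cons_val_one]
  abel

theorem lieEnd_add_lieEnd (N : L →ₗ[A] L) (X Y : L) :
    lieEnd (lieEnd X N Y) N + lieEnd (N Y) (lieEnd X N) +
        (lieEnd Y N ∘ₗ lieEnd X N - lieEnd X N ∘ₗ lieEnd Y N) + evalFirst (torsion N) ⁅X, Y⁆ =
      lieEnd Y (N ∘ₗ lieEnd X N) + lieEnd X (evalFirst (torsion N) Y) := by
  rw [evalFirst_torsion, evalFirst_torsion]
  ext Z
  simp only [LinearMap.add_apply, LinearMap.sub_apply, LinearMap.comp_apply, lieEnd_apply, map_sub,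
    lie_sub, sub_lie, lie_lie]
  abel

theorem comm_endInsertion_lieEnd_endLieDerivative (N : L →ₗ[A] L) (X : L) :
    endInsertion (lieEnd X N) * endLieDerivative N - endLieDerivative N * endInsertion (lieEnd X N) =
      endLieDerivative (N ∘ₗ lieEnd X N) - (vectorLieDerivative X * insertionEnd (torsion N) -
        insertionEnd (torsion N) * vectorLieDerivative X) := by
  rw [← sub_eq_zero]
  refine operator_eq_zero (-1) (fun F => ?_) fun Y => ?_
  · change (endInsertion (lieEnd X N) (endLieDerivative N F) -
      endLieDerivative N (endInsertion (lieEnd X N) F) - (endLieDerivative (N ∘ₗ lieEnd X N) F -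
        (vectorLieDerivative X (insertionEnd (torsion N) F) -
          insertionEnd (torsion N) (vectorLieDerivative X F)))) 0 = 0
    simp only [DirectSum.sub_apply, endInsertion_apply_zero, endLieDerivative_apply_zero,
      insertionEnd_apply_zero, vectorLieDerivative_apply_zero_of, sub_zero]
  · have h1 : contraction Y * (vectorLieDerivative X * insertionEnd (torsion N)) =
        vectorLieDerivative X * endInsertion (evalFirst (torsion N) Y) -
          vectorLieDerivative X * insertionEnd (torsion N) * contraction Y -
          (endInsertion (evalFirst (torsion N) ⁅X, Y⁆) -
            insertionEnd (torsion N) * contraction ⁅X, Y⁆) := by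
      rw [← mul_assoc, contraction_mul_vectorLieDerivative, sub_mul, mul_assoc,
        contraction_mul_insertionEnd, contraction_mul_insertionEnd]
      noncomm_ring
    have h2 : contraction Y * (insertionEnd (torsion N) * vectorLieDerivative X) =
        endInsertion (evalFirst (torsion N) Y) * vectorLieDerivative X -
          insertionEnd (torsion N) * (vectorLieDerivative X * contraction Y -
            contraction ⁅X, Y⁆) := by
      rw [← mul_assoc, contraction_mul_insertionEnd, sub_mul, mul_assoc,
        contraction_mul_vectorLieDerivative]
    have h3 := congrArg endInsertion (lieEnd_add_lieEnd N X Y)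
    simp only [endInsertion_add] at h3
    rw [← eq_sub_iff_add_eq] at h3
    rw [mul_sub, contraction_mul_comm_endInsertion_endLieDerivative, mul_sub, mul_sub, h1, h2,
      contraction_mul_endLieDerivative, vectorLieDerivative_mul_endInsertion, LinearMap.comp_apply,
      h3]
    noncomm_ring

/-- The square of the Lie derivative along `N` is the Lie derivative along its torsion. -/
theorem endLieDerivative_mul_self (N : L →ₗ[A] L) :
    endLieDerivative N * endLieDerivative N =
      insertionEnd (torsion N) * extDerivEnd + extDerivEnd * insertionEnd (torsion N) := by
  rw [← sub_eq_zero]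
  refine operator_eq_zero 1 (fun F => ?_) fun X => ?_
  · change (endLieDerivative N (endLieDerivative N F) - (insertionEnd (torsion N) (extDerivEnd F) +
      extDerivEnd (insertionEnd (torsion N) F))) 0 = 0
    simp only [DirectSum.sub_apply, DirectSum.add_apply, endLieDerivative_apply_zero,
      insertionEnd_apply_zero, extDerivEnd_apply_zero, sub_zero, add_zero]
  · have h1 : contraction X * (endLieDerivative N * endLieDerivative N) =
        vectorLieDerivative (N X) * endLieDerivative N -
          endInsertion (lieEnd X N) * endLieDerivative N - endLieDerivative N *
            (vectorLieDerivative (N X) - endInsertion (lieEnd X N) -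
              endLieDerivative N * contraction X) := by
      rw [← mul_assoc, contraction_mul_endLieDerivative, sub_mul, sub_mul, mul_assoc _ (contraction X),
        contraction_mul_endLieDerivative]
    have h2 : contraction X * (insertionEnd (torsion N) * extDerivEnd) =
        endInsertion (evalFirst (torsion N) X) * extDerivEnd -
          insertionEnd (torsion N) * (vectorLieDerivative X - extDerivEnd * contraction X) := by
      rw [← mul_assoc, contraction_mul_insertionEnd, sub_mul, mul_assoc,
        contraction_mul_extDerivEnd]
    have h3 : contraction X * (extDerivEnd * insertionEnd (torsion N)) =
        vectorLieDerivative X * insertionEnd (torsion N) -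
          extDerivEnd * (endInsertion (evalFirst (torsion N) X) -
            insertionEnd (torsion N) * contraction X) := by
      rw [← mul_assoc, contraction_mul_extDerivEnd, sub_mul, mul_assoc,
        contraction_mul_insertionEnd]
    have h4 := endLieDerivative_sub (lieEnd (N X) N) (N ∘ₗ lieEnd X N)
    rw [← evalFirst_torsion, endLieDerivative] at h4
    have h5 := comm_endInsertion_lieEnd_endLieDerivative N X
    rw [sub_eq_iff_eq_add] at h4 h5
    rw [mul_sub, mul_add, h1, h2, h3, vectorLieDerivative_mul_endLieDerivative, h4, h5]
    noncomm_ring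

theorem insertionEnd_mul_self_eq_zero {T : VectorForm A L 2}
    (hT : ∀ X Y Z : L, T ![T ![X, Y], Z] = 0) : insertionEnd T * insertionEnd T = 0 := by
  have hT' (X Y Z : L) : T ![X, T ![Y, Z]] = 0 := by rw [vectorForm_two_swap, hT, neg_zero]
  have hz : endInsertion (0 : L →ₗ[A] L) = 0 := by
    rw [← sub_self 0, endInsertion_sub, sub_self]
  have hcomp (X Y : L) : evalFirst T X ∘ₗ evalFirst T Y = 0 := by
    ext Z
    simp only [LinearMap.comp_apply, evalFirst_apply, hT', LinearMap.zero_apply]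
  have happ (X Y : L) : evalFirst T (evalFirst T X Y) = 0 := by
    ext Z
    simp only [evalFirst_apply, hT, LinearMap.zero_apply]
  have hcomm (X : L) : endInsertion (evalFirst T X) * insertionEnd T =
      insertionEnd T * endInsertion (evalFirst T X) := by
    rw [← sub_eq_zero]
    refine operator_eq_zero (-1) (fun F => ?_) fun Y => ?_
    · change (endInsertion (evalFirst T X) (insertionEnd T F) -
        insertionEnd T (endInsertion (evalFirst T X) F)) 0 = 0
      simp only [DirectSum.sub_apply, endInsertion_apply_zero, insertionEnd_apply_zero, sub_zero]
    · have h1 : contraction Y * (endInsertion (evalFirst T X) * insertionEnd T) =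
          endInsertion (evalFirst T Y) * endInsertion (evalFirst T X) -
            insertionEnd T * contraction (evalFirst T X Y) -
            endInsertion (evalFirst T X) * insertionEnd T * contraction Y := by
        rw [← mul_assoc, contraction_mul_endInsertion, add_mul, mul_assoc,
          contraction_mul_insertionEnd, contraction_mul_insertionEnd, happ, hz, mul_sub,
          endInsertion_mul_endInsertion, hcomp, hcomp, sub_zero, hz]
        noncomm_ring
      have h2 : contraction Y * (insertionEnd T * endInsertion (evalFirst T X)) =
          endInsertion (evalFirst T Y) * endInsertion (evalFirst T X) - insertionEnd T *
            (contraction (evalFirst T X Y) + endInsertion (evalFirst T X) * contraction Y) := by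
        rw [← mul_assoc, contraction_mul_insertionEnd, sub_mul, mul_assoc,
          contraction_mul_endInsertion]
      rw [mul_sub, h1, h2]
      noncomm_ring
  refine operator_eq_zero 1 (fun F => insertionEnd_apply_zero _ _) fun X => ?_
  rw [← mul_assoc, contraction_mul_insertionEnd, sub_mul, mul_assoc, contraction_mul_insertionEnd,
    hcomm]
  noncomm_ring

end Ext

section Ext
variable {A L : Type*} [CommRing A] [LieRing L] [Module A L] [LieRingModule L A]
variable [Algebra ℝ A] [LieRinehartRing A L]

theorem insertionSucc_extDerivZero_apply {m : ℕ} (S : VectorForm A L m) (f : A) (Z : Fin m → L) :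
    insertionSucc S (extDerivZero (AlternatingMap.constOfIsEmpty A L (Fin 0) f)) Z =
      ⁅S Z, f⁆ := by
  have h (σ : Equiv.Perm (Fin (m + 0))) : Equiv.Perm.sign σ • extDerivZero
      (AlternatingMap.constOfIsEmpty A L (Fin 0) f)
        (Matrix.vecCons (S fun i => Z (σ (Fin.castAdd 0 i))) fun j => Z (σ (Fin.natAdd m j))) =
      ⁅S Z, f⁆ := by
    have hS : (S fun i => Z (σ (Fin.castAdd 0 i))) = Equiv.Perm.sign σ • S Z := S.map_perm Z σ
    rw [hS]
    change Equiv.Perm.sign σ • ⁅Equiv.Perm.sign σ • S Z, f⁆ = _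
    rcases Int.units_eq_one_or (Equiv.Perm.sign σ) with h | h <;> simp [h]
  have hm : (m ! : ℝ) ≠ 0 := by exact_mod_cast m.factorial_ne_zero
  refine (insertionSucc_apply (q := 0) S _ Z).trans ?_
  rw [Finset.sum_congr rfl fun σ _ => h σ, Finset.sum_const, Finset.card_univ, Fintype.card_perm,
    Fintype.card_fin, ← Nat.cast_smul_eq_nsmul ℝ, smul_smul, add_zero, Nat.factorial_zero,
    Nat.cast_one, mul_one, inv_mul_cancel₀ hm, one_smul]

theorem insertionEnd_extDerivEnd_of_zero {m : ℕ} (S : VectorForm A L m) (f : Form A L 0) :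
    insertionEnd S (extDerivEnd (DirectSum.of (fun p => Form A L p) 0 f)) =
      DirectSum.of (fun p => Form A L p) m (insertionSucc S (extDerivZero f)) := by
  have h : extDerivEnd (DirectSum.of (fun p => Form A L p) 0 f) =
      DirectSum.of (fun p => Form A L p) 1 (extDerivZero f) := extDeriv_of_zero f
  rw [h]
  exact insertionEnd_of_succ S _

theorem lieDerivative_of_zero {m : ℕ} (S : VectorForm A L m) (f : Form A L 0) :
    lieDerivative S (DirectSum.of (fun p => Form A L p) 0 f) =
      DirectSum.of (fun p => Form A L p) m (insertionSucc S (extDerivZero f)) := by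
  rw [← insertionEnd_extDerivEnd_of_zero]
  change insertionEnd S (extDerivEnd (DirectSum.of (fun p => Form A L p) 0 f)) -
    (Int.negOnePow ((m - 1) * 1) : ℤ) • extDerivEnd (insertionEnd S
      (DirectSum.of (fun p => Form A L p) 0 f)) = _
  rw [insertionEnd_of_zero, map_zero, smul_zero, sub_zero]

/-- Vector-valued forms are determined by their insertions in exact forms `df`, if vector fields
are determined by their action on functions. -/
theorem vectorForm_eq_of_forall_of_zero
    (hL : ∀ X : L, (∀ f : A, ⁅X, f⁆ = 0) → X = 0) {m : ℕ} {S R : VectorForm A L m}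
    (h : ∀ f : Form A L 0, insertionSucc S (extDerivZero f) = insertionSucc R (extDerivZero f)) :
    S = R := by
  ext Z
  refine sub_eq_zero.1 (hL _ fun f => ?_)
  rw [sub_lie, ← insertionSucc_extDerivZero_apply, ← insertionSucc_extDerivZero_apply, h, sub_self]

theorem insertion_injective (hL : ∀ X : L, (∀ f : A, ⁅X, f⁆ = 0) → X = 0) {m : ℕ}
    {S R : VectorForm A L m} (h : insertion S = insertion R) : S = R := by
  refine vectorForm_eq_of_forall_of_zero hL fun f =>
    DirectSum.of_injective (β := fun p => Form A L p) m ?_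
  rw [← insertionEnd_extDerivEnd_of_zero, ← insertionEnd_extDerivEnd_of_zero]
  exact DFunLike.congr_fun h _

theorem lieDerivative_injective (hL : ∀ X : L, (∀ f : A, ⁅X, f⁆ = 0) → X = 0) {m : ℕ}
    {S R : VectorForm A L m} (h : lieDerivative S = lieDerivative R) : S = R := by
  refine vectorForm_eq_of_forall_of_zero hL fun f =>
    DirectSum.of_injective (β := fun p => Form A L p) m ?_
  rw [← lieDerivative_of_zero, ← lieDerivative_of_zero, h]

theorem lieDerivative_endForm (N : L →ₗ[A] L) : lieDerivative (endForm N) = endLieDerivative N := by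
  change endInsertion N * extDerivEnd - (Int.negOnePow (((1 : ℕ) - 1) * 1) : ℤ) •
    (extDerivEnd * endInsertion N) = _
  simp [endLieDerivative]

theorem lieDerivative_two (T : VectorForm A L 2) :
    lieDerivative T = insertionEnd T * extDerivEnd + extDerivEnd * insertionEnd T := by
  change insertionEnd T * extDerivEnd - (Int.negOnePow (((2 : ℕ) - 1) * 1) : ℤ) •
    (extDerivEnd * insertionEnd T) = _
  have h : Int.negOnePow (((2 : ℕ) - 1) * 1) = -1 := by
    norm_num [Int.negOnePow_one]
  rw [h, Units.val_neg, Units.val_one, neg_one_smul, sub_neg_eq_add]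

theorem lieDerivative_zero {m : ℕ} : lieDerivative (0 : VectorForm A L m) = 0 := by
  change insertionEnd 0 * extDerivEnd - (Int.negOnePow ((m - 1) * 1) : ℤ) •
    (extDerivEnd * insertionEnd 0) = 0
  rw [insertionEnd_zero, zero_mul, mul_zero, sub_eq_zero]
  exact (smul_zero _).symm

theorem isFNBracket_endForm_neg_torsion (hL : ∀ X : L, (∀ f : A, ⁅X, f⁆ = 0) → X = 0)
    (N : L →ₗ[A] L) : IsFNBracket (k := 1) (l := 2) (endForm N) (-torsion N) 0 := by
  have hc : gradedCommutator ((1 : ℕ) : ℤ) ((2 : ℕ) : ℤ) (lieDerivative (endForm N))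
      (lieDerivative (-torsion N)) = lieDerivative (0 : VectorForm A L (1 + 2)) := by
    have hneg : lieDerivative (-torsion N) = -(endLieDerivative N * endLieDerivative N) := by
      rw [lieDerivative_two, endLieDerivative_mul_self, insertionEnd_neg]
      noncomm_ring
    have h2 : Int.negOnePow (((1 : ℕ) : ℤ) * ((2 : ℕ) : ℤ)) = 1 := by
      rw [Nat.cast_one, one_mul]
      exact Int.negOnePow_even _ (by decide)
    rw [gradedCommutator, lieDerivative_zero, lieDerivative_endForm, hneg, h2, Units.val_one,
      one_smul]
    noncomm_ring
  exact ⟨hc, fun S hS => lieDerivative_injective hL (hS.symm.trans hc)⟩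

theorem isFNBracket_endForm_self (hL : ∀ X : L, (∀ f : A, ⁅X, f⁆ = 0) → X = 0) (N : L →ₗ[A] L) :
    IsFNBracket (k := 1) (l := 1) (endForm N) (endForm N) (2 • torsion N) := by
  have hc : gradedCommutator ((1 : ℕ) : ℤ) ((1 : ℕ) : ℤ) (lieDerivative (endForm N))
      (lieDerivative (endForm N)) = lieDerivative (2 • torsion N) := by
    have h2 : Int.negOnePow (((1 : ℕ) : ℤ) * ((1 : ℕ) : ℤ)) = -1 := by
      norm_num [Int.negOnePow_one]
    rw [gradedCommutator, lieDerivative_endForm, h2, lieDerivative_two, two_smul, insertionEnd_add,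
      Units.val_neg, Units.val_one, neg_one_smul, sub_neg_eq_add, endLieDerivative_mul_self]
    noncomm_ring
  exact ⟨hc, fun S hS => lieDerivative_injective hL (hS.symm.trans hc)⟩

theorem isRNBracket_self_zero (hL : ∀ X : L, (∀ f : A, ⁅X, f⁆ = 0) → X = 0)
    {T : VectorForm A L 2} (hT : ∀ X Y Z : L, T ![T ![X, Y], Z] = 0) :
    IsRNBracket (k := 1) (l := 1) T T 0 := by
  have hc : gradedCommutator ((1 : ℕ) : ℤ) ((1 : ℕ) : ℤ) (insertion T) (insertion T) =
      insertion (0 : VectorForm A L (1 + 1 + 1)) := by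
    change insertionEnd T * insertionEnd T - (Int.negOnePow (((1 : ℕ) : ℤ) * ((1 : ℕ) : ℤ)) : ℤ) •
      (insertionEnd T * insertionEnd T) = insertionEnd 0
    rw [insertionEnd_mul_self_eq_zero hT, insertionEnd_zero, sub_eq_zero]
    exact (smul_zero _).symm
  exact ⟨hc, fun S hS => insertion_injective hL (hS.symm.trans hc)⟩

theorem apply_of_mem_range {N : L →ₗ[A] L} (hN : N ∘ₗ N = N) {X : L}
    (hX : X ∈ LinearMap.range N) : N X = X := by
  obtain ⟨Y, rfl⟩ := hX
  exact DFunLike.congr_fun hN Y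

theorem apply_torsion {N : L →ₗ[A] L} (hN : N ∘ₗ N = N) (hI : HasInvolutiveImage N)
    (Z : Fin 2 → L) : N (torsion N Z) = torsion N Z := by
  have h : N ⁅N (Z 0), N (Z 1)⁆ = ⁅N (Z 0), N (Z 1)⁆ :=
    apply_of_mem_range hN (hI _ ⟨_, rfl⟩ _ ⟨_, rfl⟩)
  have hn (X : L) : N (N X) = N X := DFunLike.congr_fun hN X
  simp only [torsion_apply, map_add, map_sub, h, hn]

theorem torsion_apply_left {N : L →ₗ[A] L} (hN : N ∘ₗ N = N) (hI : HasInvolutiveImage N)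
    {X : L} (hX : N X = X) (Y : L) : torsion N ![X, Y] = 0 := by
  have h : N ⁅X, N Y⁆ = ⁅X, N Y⁆ :=
    apply_of_mem_range hN (hI _ ⟨X, hX⟩ _ ⟨_, rfl⟩)
  have hn (X : L) : N (N X) = N X := DFunLike.congr_fun hN X
  simp [torsion_apply, hX, h, hn]

theorem torsion_torsion {N : L →ₗ[A] L} (hN : N ∘ₗ N = N) (hI : HasInvolutiveImage N)
    (X Y Z : L) : torsion N ![torsion N ![X, Y], Z] = 0 :=
  torsion_apply_left hN hI (apply_torsion hN hI _) Z

theorem projection_brackets (hL : ∀ X : L, (∀ f : A, ⁅X, f⁆ = 0) → X = 0) {N : L →ₗ[A] L}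
    (hN : N ∘ₗ N = N) (hI : HasInvolutiveImage N) :
    N.compAlternatingMap (-torsion N) = -torsion N ∧
      IsFNBracket (k := 1) (l := 2) (endForm N) (-torsion N) 0 ∧
      IsRNBracket (k := 1) (l := 1) (-torsion N) (-torsion N) 0 ∧
      (∀ X Y Z : L, torsion N ![torsion N ![X, Y], Z] = 0) ∧
      IsFNBracket (k := 1) (l := 1) (endForm N) (endForm N) (2 • torsion N) := by
  refine ⟨?_, isFNBracket_endForm_neg_torsion hL N, isRNBracket_self_zero hL fun X Y Z => ?_,
    torsion_torsion hN hI, isFNBracket_endForm_self hL N⟩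
  · ext Z
    simp [apply_torsion hN hI]
  · rw [AlternatingMap.neg_apply, AlternatingMap.neg_apply, neg_eq_zero]
    exact torsion_apply_left hN hI (by rw [map_neg, apply_torsion hN hI]) Z

end Ext

section Manifold
open scoped Manifold ContDiff Bundle
variable {E : Type*} [NormedAddCommGroup E] [NormedSpace ℝ E] [FiniteDimensional ℝ E]
  {H : Type*} [TopologicalSpace H] {I : ModelWithCorners ℝ E H}
  {M : Type*} [TopologicalSpace M] [ChartedSpace H M] [IsManifold I ∞ M] [T2Space M]

/-- A vector field that annihilates all functions vanishes. -/
theorem SmoothVectorField.eq_zero_of_lie_eq_zero {X : SmoothVectorField I M}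
    (h : ∀ f : SmoothFunction I M, ⁅X, f⁆ = 0) : X = 0 := by
  ext x
  have hinv : (mfderiv I 𝓘(ℝ, E) (extChartAt I x) x).IsInvertible :=
    isInvertible_mfderiv_extChartAt (mem_extChartAt_source x)
  suffices hv : mfderiv I 𝓘(ℝ, E) (extChartAt I x) x (X x) = 0 from
    hinv.injective (hv.trans (map_zero _).symm)
  refine SeparatingDual.eq_zero_of_forall_dual_eq_zero (R := ℝ) (V := E) fun l => ?_
  let b : SmoothBumpFunction I x := Classical.arbitrary _
  let g : M → ℝ := fun y => l (extChartAt I x y)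
  have hg : ContMDiffOn I 𝓘(ℝ, ℝ) ∞ g (chartAt H x).source :=
    l.contMDiff.comp_contMDiffOn contMDiffOn_extChartAt
  let f : SmoothFunction I M := ⟨fun y => b y • g y, b.contMDiff_smul hg⟩
  have hfg : (f : M → ℝ) =ᶠ[nhds x] g := by
    filter_upwards [b.eventuallyEq_one] with y hy
    change b y • g y = g y
    rw [hy, Pi.one_apply, one_smul]
  have hd : HasMFDerivAt I 𝓘(ℝ, ℝ) g x (l.comp (mfderiv I 𝓘(ℝ, E) (extChartAt I x) x)) :=
    l.hasMFDerivAt.comp x (mdifferentiableAt_extChartAt (mem_chart_source H x)).hasMFDerivAt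
  have hx : mvfderiv I f x (X x) = 0 := congr($(h f) x)
  have hm : mfderiv I 𝓘(ℝ, ℝ) f x = l.comp (mfderiv I 𝓘(ℝ, E) (extChartAt I x) x) :=
    hfg.mfderiv_eq.trans hd.mfderiv
  exact congr($hm (X x)).symm.trans hx

theorem ComplexVectorField.eq_zero_of_lie_eq_zero {X : ComplexVectorField I M}
    (h : ∀ f : ComplexSmoothFunction I M, ⁅X, f⁆ = 0) : X = 0 := by
  have hr (f : SmoothFunction I M) := h (ComplexSmoothFunction.mk f 0)
  ext1
  · refine SmoothVectorField.eq_zero_of_lie_eq_zero fun f => ?_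
    have := congrArg ComplexSmoothFunction.re (hr f)
    simpa using this
  · refine SmoothVectorField.eq_zero_of_lie_eq_zero fun f => ?_
    have := congrArg ComplexSmoothFunction.im (hr f)
    simpa using this

end Manifold

end

end FrolicherNijenhuis

/-- First the case of real, then the case of complex vector fields.  The last conjunct says that the
explicit `torsion N` is half the Frölicher-Nijenhuis bracket of `N` with itself. -/
theorem mainTheorem9 {E : Type*} [NormedAddCommGroup E] [NormedSpace ℝ E] [FiniteDimensional ℝ E]
    {H : Type*} [TopologicalSpace H] (I : ModelWithCorners ℝ E H)
    (M : Type*) [TopologicalSpace M] [ChartedSpace H M] [IsManifold I ∞ M]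
    [BoundarylessManifold I M] [T2Space M] :
    (∀ N : SmoothVectorField I M →ₗ[SmoothFunction I M] SmoothVectorField I M,
      N ∘ₗ N = N → HasInvolutiveImage N →
      ∀ L : VectorForm (SmoothFunction I M) (SmoothVectorField I M) 2, L = -torsion N →
        N.compAlternatingMap L = -torsion N ∧
        IsFNBracket (k := 1) (l := 2) (endForm N) L 0 ∧
        IsRNBracket (k := 1) (l := 1) L L 0 ∧
        (∀ X Y Z : SmoothVectorField I M, torsion N ![torsion N ![X, Y], Z] = 0) ∧
        IsFNBracket (k := 1) (l := 1) (endForm N) (endForm N) (2 • torsion N)) ∧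
    (∀ N : ComplexVectorField I M →ₗ[ComplexSmoothFunction I M] ComplexVectorField I M,
      N ∘ₗ N = N → HasInvolutiveImage N →
      ∀ L : VectorForm (ComplexSmoothFunction I M) (ComplexVectorField I M) 2, L = -torsion N →
        N.compAlternatingMap L = -torsion N ∧
        IsFNBracket (k := 1) (l := 2) (endForm N) L 0 ∧
        IsRNBracket (k := 1) (l := 1) L L 0 ∧
        (∀ X Y Z : ComplexVectorField I M, torsion N ![torsion N ![X, Y], Z] = 0) ∧
        IsFNBracket (k := 1) (l := 1) (endForm N) (endForm N) (2 • torsion N)) := by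
  refine ⟨?_, ?_⟩
  · rintro N hN hI L rfl
    exact projection_brackets (fun _ => SmoothVectorField.eq_zero_of_lie_eq_zero) hN hI
  · rintro N hN hI L rfl
    exact projection_brackets (fun _ => ComplexVectorField.eq_zero_of_lie_eq_zero) hN hI
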